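/- Let $C$ be a set of $m\ge 1$ candidates and let $n\ge 1$ be the number of voters. A voting profile $\mathbf T=(T_1,\dots,T_n)$ consists of $n$ linear orders on $C$. The Bucklin score $s(\mathbf T,c)$ of a candidate $c$ is the smallest number $t$ such that more than half of the voters (more than $n/2$ of them) rank $c$ among their top $t$ candidates. Given a linear order $\triangleright$ on $C$ (the tiebreaker), sort the candidates by increasing Bucklin score, with ties broken by $\triangleright$; the rank of $c$ in $\mathbf T$ is its position, counted from $1$, in this order. A partial voting profile $\mathbf P=(P_1,\dots,P_n)$ consists of $n$ partial orders on $C$; a completion of $\mathbf P$ is a voting profile $\mathbf T$ in which every $T_i$ is a linear extension of $P_i$. The maximal rank of $c$ is the largest rank that $c$ has among all completions of $\mathbf P$. \textbf{Theorem.} For every fixed $k\ge 1$, the following decision problem is solvable in (deterministic) polynomial time: given $C$, a partial voting profile $\mathbf P$ with at least one voter, a candidate $c\in C$ and a tiebreaker $\triangleright$, decide whether the maximal rank of $c$ under the Bucklin rule is greater than $k$. (The polynomial may depend on $k$; the partial orders and the tiebreaker are given explicitly as $m\times m$ bit matrices.) -/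

import Mathlib

namespace BucklinRank

section Voting

variable {V C : Type}

/-- `r a b` reads "`a` is at least as preferred as `b`". The position of `c` in a linear order `r`
(`1` for the most preferred candidate): the number of candidates, `c` included, that are at least
as preferred as `c`. -/
noncomputable def position (r : C → C → Prop) (c : C) : ℕ :=
  {a : C | r a c}.ncard

/-- The number of voters who rank `c` among the top `t` candidates in the voting profile `T`. -/
noncomputable def topCount (T : V → C → C → Prop) (c : C) (t : ℕ) : ℕ :=
  {v : V | position (T v) c ≤ t}.ncard

/-- The Bucklin score of `c`: the smallest `t` such that more than half of the voters rank `c`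
among the top `t` candidates. -/
noncomputable def score (T : V → C → C → Prop) (c : C) : ℕ :=
  sInf {t : ℕ | Nat.card V < 2 * topCount T c t}

/-- The order on the candidates that sorts them by increasing Bucklin score and then by the
tiebreaker `tie`. -/
def resultOrder (T : V → C → C → Prop) (tie : C → C → Prop) (a b : C) : Prop :=
  score T a < score T b ∨ (score T a = score T b ∧ tie a b)

/-- The rank of `c` in the voting profile `T` under the tiebreaker `tie`. -/
noncomputable def rank (T : V → C → C → Prop) (tie : C → C → Prop) (c : C) : ℕ :=
  position (resultOrder T tie) c

/-- `T` is a completion of the partial profile `P`: every `T v` is a linear order that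
extends `P v`. -/
def IsCompletion (P T : V → C → C → Prop) : Prop :=
  ∀ v, IsLinearOrder C (T v) ∧ ∀ a b, P v a b → T v a b

/-- The set of ranks that `c` gets in the completions of `P`. -/
def ranks (P : V → C → C → Prop) (tie : C → C → Prop) (c : C) : Set ℕ :=
  {x | ∃ T, IsCompletion P T ∧ rank T tie c = x}

/-- The maximal rank of `c` over the completions of `P`. -/
noncomputable def maxRank (P : V → C → C → Prop) (tie : C → C → Prop) (c : C) : ℕ :=
  sSup (ranks P tie c)

/-- With at least one voter, the Bucklin score is attained: it is not a default value. -/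
theorem score_spec [Finite V] [Nonempty V] [Finite C] (T : V → C → C → Prop) (c : C) :
    Nat.card V < 2 * topCount T c (score T c) := by
  refine Nat.sInf_mem (s := {t : ℕ | Nat.card V < 2 * topCount T c t}) ⟨Nat.card C, ?_⟩
  have h : {v : V | position (T v) c ≤ Nat.card C} = Set.univ :=
    Set.eq_univ_of_forall fun v => Set.ncard_le_card _
  have h0 : 0 < Nat.card V := Nat.card_pos
  simp only [Set.mem_ofPred_eq, topCount, h, Set.ncard_univ]
  omega

/-- The maximal rank is indeed the greatest element of the set of ranks. -/
theorem isGreatest_maxRank [Finite C] (P : V → C → C → Prop)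
    (hP : ∀ v, IsPartialOrder C (P v)) (tie : C → C → Prop) (c : C) :
    IsGreatest (ranks P tie c) (maxRank P tie c) := by
  have hb : BddAbove (ranks P tie c) := by
    refine ⟨Nat.card C, ?_⟩
    rintro x ⟨T, -, rfl⟩
    exact Set.ncard_le_card _
  have hn : (ranks P tie c).Nonempty := by
    have h : ∀ v, ∃ s : C → C → Prop, IsLinearOrder C s ∧ ∀ a b, P v a b → s a b := by
      intro v
      have := hP v
      obtain ⟨s, hs, hle⟩ := extend_partialOrder (P v)
      exact ⟨s, hs, hle⟩
    choose T hT using h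
    exact ⟨_, T, hT, rfl⟩
  exact ⟨Nat.sSup_mem hn hb, fun x hx => le_csSup hb hx⟩

end Voting

/-- An input of the decision problem: a partial voting profile of `n ≥ 1` voters over `m`
candidates (`pref v a b` says that voter `v` is known to find `a` at least as good as `b`), a
tiebreaker, and a candidate. -/
structure Instance where
  m : ℕ
  n : ℕ
  voters_pos : 0 < n
  pref : Fin n → Fin m → Fin m → Prop
  pref_partial : ∀ v, IsPartialOrder (Fin m) (pref v)
  tie : Fin m → Fin m → Prop
  tie_linear : IsLinearOrder (Fin m) tie
  cand : Fin m

/-- The number `a` as `a` ones followed by a zero. -/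
def unary (a : ℕ) : List Bool :=
  List.replicate a true ++ [false]

open Classical in
/-- A relation on `m` candidates as its `m × m` matrix of bits, row by row. -/
noncomputable def relBits {m : ℕ} (r : Fin m → Fin m → Prop) : List Bool :=
  (List.finRange m).flatMap fun a => (List.finRange m).map fun b => decide (r a b)

/-- The binary string that presents an input to a machine: the numbers of candidates and voters,
the index of the given candidate, the matrix of the tiebreaker, and the matrices of the voters'
partial orders. -/
noncomputable def Instance.encode (I : Instance) : List Bool :=
  unary I.m ++ unary I.n ++ unary I.cand ++ relBits I.tie ++
    (List.finRange I.n).flatMap fun v => relBits (I.pref v)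

theorem unary_append_inj {a b : ℕ} {x y : List Bool} (h : unary a ++ x = unary b ++ y) :
    a = b ∧ x = y := by
  induction a generalizing b with
  | zero =>
    cases b with
    | zero => simpa [unary] using h
    | succ b => simp [unary, List.replicate_succ] at h
  | succ a ih =>
    cases b with
    | zero => simp [unary, List.replicate_succ] at h
    | succ b =>
      have := ih (b := b) (by simpa [unary, List.replicate_succ] using h)
      exact ⟨by omega, this.2⟩

theorem flatMap_inj {ι : Type} {l : List ι} {f g : ι → List Bool}
    (hl : ∀ i, (f i).length = (g i).length) (h : l.flatMap f = l.flatMap g) :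
    ∀ i ∈ l, f i = g i := by
  induction l with
  | nil => simp
  | cons a l ih =>
    rw [List.flatMap_cons, List.flatMap_cons] at h
    have h' := List.append_inj h (hl a)
    intro i hi
    rcases List.mem_cons.1 hi with rfl | hi
    · exact h'.1
    · exact ih h'.2 i hi

theorem relBits_length {m : ℕ} (r : Fin m → Fin m → Prop) : (relBits r).length = m * m := by
  simp [relBits, List.length_flatMap]

theorem relBits_injective {m : ℕ} {r s : Fin m → Fin m → Prop} (h : relBits r = relBits s) :
    r = s := by
  funext a b
  have h1 := flatMap_inj (by simp) h a (List.mem_finRange a)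
  simpa using List.map_inj_left.1 h1 b (List.mem_finRange b)

/-- The presentation of inputs as strings loses no information. -/
theorem Instance.encode_injective : Function.Injective Instance.encode := by
  rintro ⟨m, n, hn, p, hp, t, ht, c⟩ ⟨m', n', hn', p', hp', t', ht', c'⟩ h
  simp only [Instance.encode, List.append_assoc] at h
  obtain ⟨rfl, ha⟩ := unary_append_inj h
  obtain ⟨rfl, hb⟩ := unary_append_inj ha
  obtain ⟨hc, hd⟩ := unary_append_inj hb
  obtain rfl := Fin.ext hc
  obtain ⟨h1, h2⟩ := List.append_inj hd (by simp [relBits_length])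
  obtain rfl := relBits_injective h1
  have h3 : p = p' := by
    funext v
    exact relBits_injective
      (flatMap_inj (by simp [relBits_length]) h2 v (List.mem_finRange v))
  subst h3
  rfl

open Classical in
/-- The answer to an input, for the fixed number `k`: is the maximal rank of the given candidate
greater than `k`? -/
noncomputable def maxRankExceeds (k : ℕ) (I : Instance) : Bool :=
  decide (k < maxRank I.pref I.tie I.cand)

end BucklinRank

/-- The problem with inputs `α`, presented as strings by `enc`, and yes-no answers `f` is solvable
in polynomial time: a (multi-stack) Turing machine computes the answer to every input `a` within a number of
steps that is polynomial in the length of `enc a`. -/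
def DecidableInPolyTime {α Γ : Type} (enc : α → List Γ) (f : α → Bool) : Prop :=
  Nonempty (Turing.TM2ComputableInPolyTime enc Computability.encodeBool f)

/-! The rank of `c` exceeds `k` exactly when some `k` distinct rivals come before `c`. Fix the
rivals `d` and a threshold `s` below the score of `c`: a rival favoured by the tiebreaker must reach
a majority by position `s + 1`, any other rival by position `s`, and at least half of the voters
must keep `c` out of their top `s` (`lt_rank_iff`). All of these are lower bounds on numbers of
voters, so a voter matters only through a vote type: which rivals are placed in time, and whether
`c` is kept out. For fixed `k` there are boundedly many types.

Whether a partial order admits a vote of a given type is settled by counting: the candidates forced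
above the chosen rivals must fit into the available positions, and enough candidates must be free to
precede `c` (`Feasible.exists_extension`, `feasible_of_extension`). Voters with the same set `A` of
feasible types are interchangeable, so only the numbers `x A t` of voters in class `A` that use type
`t` are relevant (`exists_choice_iff`). For fixed `k` this leaves boundedly many unknowns, each of
size at most the input length, and the search through them is polynomial (`lt_maxRank_iff`).

To obtain an actual Turing machine, the search is written as an arithmetical term with bounded sums,
existential quantifiers being sums. Terms compile to structured programs on unary stacks, whose time
is polynomial because values are (`Term.run_compile`), and such programs are simulated step for step
by a multi-stack machine (`Exec.steps`). -/

/-! ### Structured stack programs and their simulation by Turing machines -/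

namespace StackProgram

open Function

/-- Structured programs over stacks of bits, the stacks being indexed by natural numbers.
`pop n c d` pops stack `n` and runs `c` or `d` according to the bit (and does nothing if the stack
is empty); `loop n c d` repeats this until stack `n` is empty. -/
inductive Cmd
  | skip : Cmd
  | push : ℕ → Bool → Cmd
  | seq : Cmd → Cmd → Cmd
  | pop : ℕ → Cmd → Cmd → Cmd
  | loop : ℕ → Cmd → Cmd → Cmd

/-- The contents of all stacks. -/
abbrev Store := ℕ → List Bool

/-- `Exec c s s' t`: the program `c` takes the store `s` to the store `s'` in `t` steps. -/
inductive Exec : Cmd → Store → Store → ℕ → Prop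
  | skip {s} : Exec .skip s s 1
  | push {s n b} : Exec (.push n b) s (update s n (b :: s n)) 1
  | seq {c d s s' s'' t t'} : Exec c s s' t → Exec d s' s'' t' → Exec (.seq c d) s s'' (t + t')
  | pop_nil {n c d s} : s n = [] → Exec (.pop n c d) s s 1
  | pop_cons {n c d s s' b l t} : s n = b :: l →
      Exec (bif b then c else d) (update s n l) s' t → Exec (.pop n c d) s s' (1 + t)
  | loop_nil {n c d s} : s n = [] → Exec (.loop n c d) s s 1
  | loop_cons {n c d s s' s'' b l t t'} : s n = b :: l →
      Exec (bif b then c else d) (update s n l) s' t → Exec (.loop n c d) s' s'' t' →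
      Exec (.loop n c d) s s'' (1 + t + t')

namespace Cmd

/-- The control points of a program. -/
def Lab : Cmd → Type
  | skip => Unit
  | push _ _ => Unit
  | seq c d => c.Lab ⊕ d.Lab
  | pop _ c d => Unit ⊕ (c.Lab ⊕ d.Lab)
  | loop _ c d => Unit ⊕ (c.Lab ⊕ d.Lab)

/-- A program has finitely many control points. -/
@[reducible] def labFintype : (c : Cmd) → Fintype c.Lab
  | skip => inferInstanceAs (Fintype Unit)
  | push _ _ => inferInstanceAs (Fintype Unit)
  | seq c d => @instFintypeSum _ _ c.labFintype d.labFintype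
  | pop _ c d => @instFintypeSum _ _ inferInstance (@instFintypeSum _ _ c.labFintype d.labFintype)
  | loop _ c d => @instFintypeSum _ _ inferInstance (@instFintypeSum _ _ c.labFintype d.labFintype)

/-- The control point at which a program starts. -/
def entry : (c : Cmd) → c.Lab
  | skip => ()
  | push _ _ => ()
  | seq c _ => .inl c.entry
  | pop _ _ _ => .inl ()
  | loop _ _ _ => .inl ()

/-- A number larger than the index of every stack that occurs in the program. -/
def bound : Cmd → ℕ
  | skip => 0
  | push n _ => n + 1
  | seq c d => max c.bound d.bound
  | pop n c d => max (n + 1) (max c.bound d.bound)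
  | loop n c d => max (n + 1) (max c.bound d.bound)

/-- Statements of a machine with `M` stacks of bits whose internal state holds the last bit
popped. -/
abbrev MStmt (M : ℕ) (L : Type) := Turing.TM2.Stmt (fun _ : Fin M => Bool) L (Option Bool)

/-- Stack `n` of a machine with `M` stacks. -/
def stackIx (M : ℕ) [NeZero M] (n : ℕ) : Fin M := Fin.ofNat M n

theorem stackIx_val {M : ℕ} [NeZero M] {n : ℕ} (h : n < M) : (stackIx M n : ℕ) = n :=
  Nat.mod_eq_of_lt h

/-- Pop stack `k` and jump to one of three labels. -/
def popGoto {M : ℕ} {L : Type} (k : Fin M) (l₁ l₀ l : L) : MStmt M L :=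
  .pop k (fun _ o => o)
    (.branch (fun o => o == some true) (.load (fun _ => none) (.goto fun _ => l₁))
      (.branch (fun o => o == some false) (.load (fun _ => none) (.goto fun _ => l₀))
        (.load (fun _ => none) (.goto fun _ => l))))

/-- The machine code of a program: `emb` embeds its control points into the labels of the machine,
and `ex` is the label to jump to at the end. -/
def code (M : ℕ) [NeZero M] : (c : Cmd) → {L : Type} → (c.Lab → L) → L → c.Lab → MStmt M L
  | skip, _, _, ex, _ => .goto fun _ => ex
  | push n b, _, _, ex, _ => .push (stackIx M n) (fun _ => b) (.goto fun _ => ex)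
  | seq c d, _, emb, _, .inl l => c.code M (fun x => emb (.inl x)) (emb (.inr d.entry)) l
  | seq _ d, _, emb, ex, .inr l => d.code M (fun x => emb (.inr x)) ex l
  | pop n c d, _, emb, ex, .inl _ =>
      popGoto (stackIx M n) (emb (.inr (.inl c.entry))) (emb (.inr (.inr d.entry))) ex
  | pop _ c _, _, emb, ex, .inr (.inl l) => c.code M (fun x => emb (.inr (.inl x))) ex l
  | pop _ _ d, _, emb, ex, .inr (.inr l) => d.code M (fun x => emb (.inr (.inr x))) ex l
  | loop n c d, _, emb, ex, .inl _ =>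
      popGoto (stackIx M n) (emb (.inr (.inl c.entry))) (emb (.inr (.inr d.entry))) ex
  | loop _ c _, _, emb, _, .inr (.inl l) =>
      c.code M (fun x => emb (.inr (.inl x))) (emb (.inl ())) l
  | loop _ _ d, _, emb, _, .inr (.inr l) =>
      d.code M (fun x => emb (.inr (.inr x))) (emb (.inl ())) l

end Cmd

section Simulation

variable {M : ℕ} {L : Type}

/-- The machine configuration at label `l` with the store `s`. -/
def cfg (l : L) (s : Store) : Turing.TM2.Cfg (fun _ : Fin M => Bool) L (Option Bool) :=
  ⟨some l, none, fun k => s k⟩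

/-- The machine `m` gets from one configuration to another in `t` steps. -/
def Steps (m : L → Cmd.MStmt M L) (a b : Turing.TM2.Cfg (fun _ : Fin M => Bool) L (Option Bool))
    (t : ℕ) : Prop :=
  (flip bind (Turing.TM2.step m))^[t] (some a) = some b

theorem Steps.trans {m : L → Cmd.MStmt M L} {a b c} {t t' : ℕ} (h : Steps m a b t)
    (h' : Steps m b c t') : Steps m a c (t + t') := by
  unfold Steps at *
  rw [add_comm, iterate_add_apply, h, h']

theorem update_stackIx [NeZero M] {n : ℕ} (hn : n < M) (s : Store) (x : List Bool) :
    update (fun k : Fin M => s k) (Cmd.stackIx M n) x = fun k : Fin M => update s n x k := by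
  have hv := Cmd.stackIx_val (M := M) hn
  funext k
  by_cases h : (k : ℕ) = n
  · have : k = Cmd.stackIx M n := Fin.ext (h.trans hv.symm)
    subst this
    rw [update_self, hv, update_self]
  · have : k ≠ Cmd.stackIx M n := fun e => h (by rw [e, hv])
    rw [update_of_ne this, update_of_ne h]

/-- Every branch resets the internal state to `none`, so that each control point is entered in a
configuration of the form `cfg`, and steps can be chained. -/
theorem steps_popGoto [NeZero M] {m : L → Cmd.MStmt M L} {l l₁ l₀ l' : L} {n : ℕ} (hn : n < M)
    (hm : m l = Cmd.popGoto (Cmd.stackIx M n) l₁ l₀ l') (s : Store) :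
    (s n = [] → Steps m (cfg l s) (cfg l' s) 1) ∧
    ∀ b x, s n = b :: x → Steps m (cfg l s) (cfg (bif b then l₁ else l₀) (update s n x)) 1 := by
  have hv := Cmd.stackIx_val (M := M) hn
  constructor
  · intro h
    -- The machine replaces even an empty stack by its tail, which is again empty.
    have h2 : update s n [] = s := by rw [← h, update_eq_self]
    simp only [Steps, flip, cfg, hm, Cmd.popGoto, Turing.TM2.step, Turing.TM2.stepAux, hv, h,
      update_stackIx hn, iterate_one, Option.bind_eq_bind, Option.bind_some, List.head?_nil,
      List.tail_nil, h2]
    rfl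
  · intro b x h
    cases b <;>
    · simp [Steps, flip, cfg, hm, Cmd.popGoto, Turing.TM2.step, Turing.TM2.stepAux, hv, h]
      rw [update_stackIx hn]

/-- The machine code of a program does what the program does. -/
theorem Exec.steps [NeZero M] {c : Cmd} {s s' : Store} {t : ℕ} (h : Exec c s s' t) :
    ∀ {m : L → Cmd.MStmt M L} {emb : c.Lab → L} {ex : L}, c.bound ≤ M →
      (∀ l, m (emb l) = c.code M emb ex l) → Steps m (cfg (emb c.entry) s) (cfg ex s') t := by
  induction h with
  | skip =>
    intro m emb ex hM hm
    have := hm ()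
    simp [Cmd.code] at this
    simp [Steps, flip, cfg, Cmd.entry, Turing.TM2.step, this]
  | @push s n b =>
    intro m emb ex hM hm
    have := hm ()
    have hn : n < M := hM
    have hv := Cmd.stackIx_val (M := M) hn
    simp [Cmd.code] at this
    simp [Steps, flip, cfg, Cmd.entry, Turing.TM2.step, this, hv]
    exact update_stackIx hn _ _
  | seq _ _ ih₁ ih₂ =>
    intro m emb ex hM hm
    have hM' := max_le_iff.1 hM
    exact (ih₁ hM'.1 fun l => hm (.inl l)).trans (ih₂ hM'.2 fun l => hm (.inr l))
  | pop_nil h =>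
    intro m emb ex hM hm
    have hM' := max_le_iff.1 hM
    exact (steps_popGoto hM'.1 (hm (.inl ())) _).1 h
  | @pop_cons n c d s s' b l t h _ ih =>
    intro m emb ex hM hm
    have hM' := max_le_iff.1 hM
    have hM'' := max_le_iff.1 hM'.2
    refine ((steps_popGoto hM'.1 (hm (.inl ())) _).2 b l h).trans ?_
    cases b
    · exact ih hM''.2 fun l => hm (.inr (.inr l))
    · exact ih hM''.1 fun l => hm (.inr (.inl l))
  | loop_nil h =>
    intro m emb ex hM hm
    have hM' := max_le_iff.1 hM
    exact (steps_popGoto hM'.1 (hm (.inl ())) _).1 h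
  | @loop_cons n c d s s' s'' b l t t' h _ _ ih ih' =>
    intro m emb ex hM hm
    have hM' := max_le_iff.1 hM
    have hM'' := max_le_iff.1 hM'.2
    -- The exit label of the body is the head of the loop, so the remaining iterations start at the
    -- same entry point.
    refine (((steps_popGoto hM'.1 (hm (.inl ())) _).2 b l h).trans ?_).trans (ih' hM hm)
    cases b
    · exact ih hM''.2 fun l => hm (.inr (.inr l))
    · exact ih hM''.1 fun l => hm (.inr (.inl l))

end Simulation

theorem initList_stk_self (tm : Turing.FinTM2) (s : List (tm.Γ tm.k₀)) :
    (Turing.initList tm s).stk tm.k₀ = s :=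
  dif_pos rfl

theorem initList_stk_of_ne (tm : Turing.FinTM2) (s : List (tm.Γ tm.k₀)) {k : tm.K}
    (h : k ≠ tm.k₀) : (Turing.initList tm s).stk k = [] :=
  dif_neg h

theorem haltList_stk_self (tm : Turing.FinTM2) (s : List (tm.Γ tm.k₁)) :
    (Turing.haltList tm s).stk tm.k₁ = s :=
  dif_pos rfl

theorem haltList_stk_of_ne (tm : Turing.FinTM2) (s : List (tm.Γ tm.k₁)) {k : tm.K}
    (h : k ≠ tm.k₁) : (Turing.haltList tm s).stk k = [] :=
  dif_neg h

/-- The Turing machine that runs a program, with input on stack `0` and output on stack `1`. -/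
def machine (c : Cmd) : Turing.FinTM2 where
  K := Fin (c.bound + 2)
  k₀ := 0
  k₁ := 1
  Γ := fun _ => Bool
  Λ := Option c.Lab
  main := some c.entry
  ΛFin := @instFintypeOption _ c.labFintype
  σ := Option Bool
  initialState := none
  m := fun l => match l with
    | none => .halt
    | some l => c.code (c.bound + 2) some none l

/-- A decision problem solved by a program in polynomial time is solvable in polynomial time by a
Turing machine. -/
theorem decidableInPolyTime_of_exec {α : Type} {enc : α → List Bool} {f : α → Bool} (c : Cmd)
    (p : Polynomial ℕ)
    (h : ∀ a, ∃ t ≤ p.eval (enc a).length,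
      Exec c (update (fun _ => []) 0 (enc a)) (update (fun _ => []) 1 [f a]) t) :
    DecidableInPolyTime enc f := by
  have key : ∀ a, ∃ t ≤ (p + 1).eval (enc a).length,
      (flip bind (machine c).step)^[t] (some (Turing.initList (machine c) (enc a))) =
        some (Turing.haltList (machine c) [f a]) := by
    intro a
    obtain ⟨t, ht, he⟩ := h a
    -- The bound is raised by two so that the input stack `0` and the output stack `1` exist
    -- whatever the program uses.
    have hs := he.steps (M := c.bound + 2) (m := (machine c).m) (emb := some) (ex := none)
      (by omega) (fun l => rfl)
    -- The additional step executes the `halt` statement at the exit label.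
    refine ⟨t + 1, by simpa using ht, ?_⟩
    have h0 : Turing.initList (machine c) (enc a) =
        cfg (M := c.bound + 2) (some c.entry) (update (fun _ => []) 0 (enc a)) := by
      have h1 : (Turing.initList (machine c) (enc a)).stk =
          fun k : Fin (c.bound + 2) => update (fun _ => []) 0 (enc a) (k : ℕ) := by
        funext k
        by_cases hk : k = (machine c).k₀
        · subst hk
          exact initList_stk_self _ _
        · have : Fin.val (n := c.bound + 2) k ≠ 0 := fun e => hk (Fin.ext e)
          exact (initList_stk_of_ne _ _ hk).trans (update_of_ne this _ (fun _ => [])).symm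
      exact congrArg (Turing.TM2.Cfg.mk _ _) h1
    have h2 : (Turing.haltList (machine c) [f a]).stk =
        fun k : Fin (c.bound + 2) => update (fun _ => []) 1 [f a] (k : ℕ) := by
      funext k
      by_cases hk : k = (machine c).k₁
      · subst hk
        exact haltList_stk_self _ _
      · have : Fin.val (n := c.bound + 2) k ≠ 1 := fun e => hk (Fin.ext (e.trans (by
          simp [machine])))
        exact (haltList_stk_of_ne _ _ hk).trans (update_of_ne this _ (fun _ => [])).symm
    rw [h0, add_comm, iterate_add_apply]
    erw [hs]
    exact congrArg some (congrArg (Turing.TM2.Cfg.mk _ _) h2.symm)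
  choose t ht hk using key
  exact ⟨{ tm := machine c
           inputAlphabet := Equiv.refl _
           outputAlphabet := Equiv.refl _
           time := p + 1
           outputsFun := fun a =>
            { steps := t a
              evals_in_steps := by
                have e : ∀ l : List Bool, List.map (Equiv.refl Bool).invFun l = l :=
                  fun l => List.map_id l
                refine Eq.trans ?_ ((hk a).trans ?_)
                · congr 2
                  congr 1
                  exact e _
                · rfl
              steps_le_m := ht a } }⟩

end StackProgram

/-! ### Time-bounded runs and basic operations on unary numbers -/

namespace StackProgram

open Function

/-- The program `c` takes the store `s` to the store `s'` in at most `T` steps. -/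
def Run (c : Cmd) (s s' : Store) (T : ℕ) : Prop :=
  ∃ t ≤ T, Exec c s s' t

namespace Run

variable {c d : Cmd} {s s' s'' : Store} {T T' n : ℕ} {b : Bool}

theorem mono (h : Run c s s' T) (hT : T ≤ T') : Run c s s' T' :=
  let ⟨t, ht, he⟩ := h
  ⟨t, ht.trans hT, he⟩

theorem skip : Run .skip s s 1 :=
  ⟨1, le_rfl, .skip⟩

/-- Chained runs describe the same store by different nested updates; this separates the proof of
those equalities from the composition of runs. -/
theorem congr {r r' : Store} (h : Run c s s' T) (hs : r = s) (hs' : r' = s') (hT : T ≤ T') :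
    Run c r r' T' := by
  subst hs hs'
  exact h.mono hT

theorem push : Run (.push n b) s (update s n (b :: s n)) 1 :=
  ⟨1, le_rfl, .push⟩

theorem seq (h : Run c s s' T) (h' : Run d s' s'' T') : Run (.seq c d) s s'' (T + T') :=
  let ⟨t, ht, he⟩ := h
  let ⟨t', ht', he'⟩ := h'
  ⟨t + t', by omega, .seq he he'⟩

theorem pop_nil (h : s n = []) : Run (.pop n c d) s s 1 :=
  ⟨1, le_rfl, .pop_nil h⟩

theorem pop_cons {l : List Bool} (h : s n = b :: l)
    (h' : Run (bif b then c else d) (update s n l) s' T) : Run (.pop n c d) s s' (1 + T) :=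
  let ⟨t, ht, he⟩ := h'
  ⟨1 + t, by omega, .pop_cons h he⟩

/-- A loop runs through the contents of its stack. -/
theorem loop (l : List Bool) {S : ℕ → Store} (h : ∀ i ≤ l.length, S i n = l.drop i)
    (hS : ∀ (i : ℕ) (hi : i < l.length),
      Run (bif l[i] then c else d) (update (S i) n (l.drop (i + 1))) (S (i + 1)) T) :
    Run (.loop n c d) (S 0) (S l.length) (l.length * (T + 1) + 1) := by
  induction l generalizing S with
  | nil => exact ⟨1, by simp, .loop_nil (h 0 le_rfl)⟩
  | cons b l ih =>
    -- Shifting the invariant by one makes the rest of the loop an instance of the induction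
    -- hypothesis.
    obtain ⟨t, ht, he⟩ := ih (S := fun i => S (i + 1))
      (fun i hi => h (i + 1) (Nat.succ_le_succ hi)) (fun i hi => hS (i + 1) (Nat.succ_lt_succ hi))
    obtain ⟨t', ht', he'⟩ := hS 0 (Nat.succ_pos _)
    refine ⟨1 + t' + t, ?_, .loop_cons (h 0 (Nat.zero_le _)) he' he⟩
    rw [List.length_cons, add_mul]
    omega

/-- A loop over a unary number. -/
theorem loop_replicate (k : ℕ) {S : ℕ → Store} (h : ∀ i ≤ k, S i n = List.replicate (k - i) true)
    (hS : ∀ i < k, Run c (update (S i) n (List.replicate (k - (i + 1)) true)) (S (i + 1)) T) :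
    Run (.loop n c d) (S 0) (S k) (k * (T + 1) + 1) := by
  have := loop (c := c) (d := d) (n := n) (T := T) (List.replicate k true) (S := S)
    (by simpa using h) (fun i hi => by simpa using hS i (by simpa using hi))
  simpa using this

end Run

/-- Add one to a unary number. -/
abbrev inc (n : ℕ) : Cmd := .push n true

/-- Move a unary number. -/
abbrev mov (a b : ℕ) : Cmd := .loop a (inc b) .skip

theorem run_mov {a b : ℕ} (hab : a ≠ b) {s : Store} {k : ℕ} (h : s a = List.replicate k true) :
    Run (mov a b) s (update (update s a []) b (List.replicate k true ++ s b)) (k * 2 + 1) := by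
  have := Run.loop_replicate (c := inc b) (d := .skip) (n := a) (T := 1) k
    (S := fun i => update (update s a (List.replicate (k - i) true)) b
      (List.replicate i true ++ s b)) (by intro i hi; simp [hab]) (by
      intro i hi
      convert Run.push using 1
      funext j
      by_cases h1 : j = a <;> by_cases h2 : j = b <;> simp_all [List.replicate_succ])
  convert this using 1
  · funext j
    by_cases h1 : j = a <;> by_cases h2 : j = b <;> simp_all
  · simp

/-- Subtract one from a unary number. -/
theorem run_pop_skip {a : ℕ} {s : Store} {k : ℕ} (h : s a = List.replicate k true) :
    Run (.pop a .skip .skip) s (update s a (List.replicate (k - 1) true)) 2 := by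
  cases k with
  | zero =>
    refine (Run.pop_nil h).congr rfl ?_ (by omega)
    rw [← h, update_eq_self]
  | succ k => exact Run.pop_cons h Run.skip

/-- Clear a stack that holds a unary number. -/
abbrev clear (a : ℕ) : Cmd := .loop a .skip .skip

theorem run_clear {a : ℕ} {s : Store} {l : List Bool} (h : s a = l) :
    Run (clear a) s (update s a []) (l.length * 2 + 1) := by
  have := Run.loop (c := .skip) (d := .skip) (n := a) (T := 1) l
    (S := fun i => update s a (l.drop i)) (by intro i hi; simp) (by
      intro i hi
      have e : (bif l[i] then Cmd.skip else Cmd.skip) = .skip := by cases l[i] <;> rfl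
      rw [e]
      convert Run.skip using 1
      simp)
  convert this using 1
  · subst h
    simp
  · simp

/-- Move the contents of a stack, in reverse order, onto another one. -/
abbrev transfer (a b : ℕ) : Cmd := .loop a (.push b true) (.push b false)

theorem run_transfer {a b : ℕ} (hab : a ≠ b) {s : Store} {l : List Bool} (h : s a = l) :
    Run (transfer a b) s (update (update s a []) b (l.reverse ++ s b)) (l.length * 2 + 1) := by
  have := Run.loop (c := .push b true) (d := .push b false) (n := a) (T := 1) l
    (S := fun i => update (update s a (l.drop i)) b ((l.take i).reverse ++ s b))
    (by intro i hi; simp [hab]) (by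
      intro i hi
      have e : (bif l[i] then Cmd.push b true else Cmd.push b false) = .push b l[i] := by
        cases l[i] <;> rfl
      have e' : (l.take (i + 1)).reverse = l[i] :: (l.take i).reverse := by
        rw [← List.take_append_getElem hi]
        simp
      rw [e, e']
      convert Run.push using 1
      funext j
      by_cases h2 : j = b
      · subst h2
        simp [hab.symm]
      · by_cases h1 : j = a <;> simp [h1, h2, hab])
  convert this using 1
  · funext j
    by_cases h1 : j = a <;> by_cases h2 : j = b <;> simp_all
  · simp

end StackProgram

/-! ### Arithmetical terms and their compilation to polynomial-time programs -/

/-- Arithmetical terms with variables from `V` that can read the bits of a string and sum over the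
numbers below a bound. -/
inductive Term (V : Type)
  | var : V → Term V
  | one : Term V
  | add : Term V → Term V → Term V
  | sub : Term V → Term V → Term V
  | mul : Term V → Term V → Term V
  | bit : Term V → Term V
  | sum : V → Term V → Term V → Term V

namespace Term

open Function StackProgram

variable {V : Type} [DecidableEq V]

/-- The value of a term for the string `w` and the assignment `e`. In `sum x b t`, the variable `x`
runs through the numbers below the value of `b`. -/
def eval (w : List Bool) : (V → ℕ) → Term V → ℕ
  | e, var x => e x
  | _, one => 1
  | e, add a b => eval w e a + eval w e b
  | e, sub a b => eval w e a - eval w e b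
  | e, mul a b => eval w e a * eval w e b
  | e, bit a => (w.getD (eval w e a) false).toNat
  | e, sum x b t => ∑ i ∈ Finset.range (eval w e b), eval w (update e x i) t

/-- The program that adds the value of a term to the unary number on stack `dst`. Variable `x` is
on stack `ν x`, the string on stack `0`; the auxiliary stacks are stack `2` and the stacks from
`base` on. -/
def compile (ν : V → ℕ) : Term V → ℕ → ℕ → Cmd
  | var x, dst, base =>
      .seq (.loop (ν x) (.seq (inc dst) (inc base)) .skip) (mov base (ν x))
  | one, dst, _ => inc dst
  | add a b, dst, base => .seq (compile ν a dst base) (compile ν b dst base)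
  | sub a b, dst, base =>
      .seq (compile ν a base (base + 2)) (.seq (compile ν b (base + 1) (base + 2))
        (.seq (.loop (base + 1) (.pop base .skip .skip) .skip) (mov base dst)))
  | mul a b, dst, base =>
      .seq (compile ν a base (base + 1)) (.loop base (compile ν b dst (base + 1)) .skip)
  | bit a, dst, base =>
      .seq (compile ν a base (base + 1))
        (.seq (.loop base (.pop 0 (.push 2 true) (.push 2 false)) .skip)
          (.seq (.pop 0 (.seq (inc dst) (.push 0 true)) (.push 0 false)) (transfer 2 0)))
  | sum x b t, dst, base =>
      .seq (compile ν b base (base + 2)) (.seq (mov (ν x) (base + 1))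
        (.seq (.loop base (.seq (compile ν t dst (base + 2)) (inc (ν x))) .skip)
          (.seq (clear (ν x)) (mov (base + 1) (ν x)))))

open Polynomial in
/-- A bound on the value of a term in terms of a bound on the variables. -/
noncomputable def valueBound : Term V → ℕ[X]
  | var _ => X
  | one => 1
  | add a b => a.valueBound + b.valueBound
  | sub a _ => a.valueBound
  | mul a b => a.valueBound * b.valueBound
  | bit _ => 1
  | sum _ b t => b.valueBound * t.valueBound.comp (X + b.valueBound)

open Polynomial in
/-- A bound on the running time of the program for a term, in terms of a bound on the variables and
on the length of the string. -/
noncomputable def timeBound : Term V → ℕ[X]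
  | var _ => X * 5 + 2
  | one => 1
  | add a b => a.timeBound + b.timeBound
  | sub a b => a.timeBound + (b.timeBound + ((b.valueBound * 3 + 1) + (a.valueBound * 2 + 1)))
  | mul a b => a.timeBound + (a.valueBound * (b.timeBound + 1) + 1)
  | bit a => a.timeBound + ((a.valueBound * 3 + 1) + (3 + (X * 2 + 1)))
  | sum _ b t => b.timeBound + ((X * 2 + 1) +
      ((b.valueBound * (t.timeBound.comp (X + b.valueBound) + 1 + 1) + 1) +
        ((b.valueBound * 2 + 1) + (X * 2 + 1))))

/-- Numbers are stored in unary, so running times depend on values and these must stay polynomial.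
Under a sum the bound variable may exceed `X`, but not `X` plus the bound on the range; hence the
composition in `valueBound`. -/
theorem eval_le_valueBound (w : List Bool) {e : V → ℕ} {X : ℕ} (t : Term V) (he : ∀ x, e x ≤ X) :
    eval w e t ≤ t.valueBound.eval X := by
  induction t generalizing e X with
  | var x => simpa [eval, valueBound] using he x
  | one => simp [eval, valueBound]
  | add a b iha ihb => simpa [eval, valueBound] using add_le_add (iha he) (ihb he)
  | sub a b iha ihb => exact (Nat.sub_le _ _).trans (iha he)
  | mul a b iha ihb => simpa [eval, valueBound] using Nat.mul_le_mul (iha he) (ihb he)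
  | bit a iha => simpa [eval, valueBound] using Bool.toNat_le _
  | sum x b t ihb iht =>
    simp only [eval, valueBound, Polynomial.eval_mul, Polynomial.eval_comp, Polynomial.eval_add,
      Polynomial.eval_X]
    have hb := ihb he
    refine (Finset.sum_le_card_nsmul _ _ (t.valueBound.eval (X + b.valueBound.eval X)) ?_).trans ?_
    · intro i hi
      refine iht fun y => ?_
      have := Finset.mem_range.1 hi
      have := he y
      by_cases h : y = x <;> simp [h] <;> omega
    · simpa using Nat.mul_le_mul_right _ hb

/-- The variables are on distinct stacks below `B`, other than the first three. -/
structure Layout (ν : V → ℕ) (B : ℕ) : Prop where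
  inj : Injective ν
  ge : ∀ x, 3 ≤ ν x
  lt : ∀ x, ν x < B

/-- The store holds the string `w` and the variables `e`, and the auxiliary stacks are empty. -/
structure Holds (ν : V → ℕ) (w : List Bool) (e : V → ℕ) (base : ℕ) (s : Store) : Prop where
  input : s 0 = w
  aux : s 2 = []
  vars : ∀ x, s (ν x) = List.replicate (e x) true
  temps : ∀ j ≥ base, s j = []

section

variable {ν : V → ℕ} {B : ℕ} {w : List Bool} {e : V → ℕ} {base base' k : ℕ} {s : Store}

omit [DecidableEq V] in
theorem Holds.mono (h : Holds ν w e base s) (hb : base ≤ base') : Holds ν w e base' s :=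
  ⟨h.input, h.aux, h.vars, fun j hj => h.temps j (hb.trans hj)⟩

omit [DecidableEq V] in
theorem Holds.update (hν : Layout ν B) (hB : 3 ≤ B) (h : Holds ν w e base s) (h1 : B ≤ k)
    (h2 : k < base) (l : List Bool) : Holds ν w e base (Function.update s k l) where
  input := by rw [update_of_ne (by omega), h.input]
  aux := by rw [update_of_ne (by omega), h.aux]
  vars x := by rw [update_of_ne (by have := hν.lt x; omega), h.vars]
  temps j hj := by rw [update_of_ne (by omega), h.temps j hj]

theorem Holds.update_var (hν : Layout ν B) (h : Holds ν w e base s) (hb : B ≤ base)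
    (x : V) (i : ℕ) : Holds ν w (Function.update e x i) base
      (Function.update s (ν x) (List.replicate i true)) where
  input := by rw [update_of_ne (by have := hν.ge x; omega), h.input]
  aux := by rw [update_of_ne (by have := hν.ge x; omega), h.aux]
  vars y := by
    by_cases hy : y = x
    · subst hy
      simp
    · rw [update_of_ne hy, update_of_ne (hν.inj.ne hy), h.vars]
  temps j hj := by rw [update_of_ne (by have := hν.lt x; omega), h.temps j hj]

/-- The program for a term computes its value in the time given by `timeBound`. -/
theorem run_compile (hν : Layout ν B) (hB : 3 ≤ B) (t : Term V) :
    ∀ {e : V → ℕ} {X dst base : ℕ} {s : Store}, (∀ x, e x ≤ X) → w.length ≤ X →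
      Holds ν w e base s → B ≤ dst → dst < base →
      Run (compile ν t dst base) s
        (Function.update s dst (List.replicate (eval w e t) true ++ s dst))
        (t.timeBound.eval X) := by
  induction t with
  | var x =>
    intro e X dst base s he hw h h1 h2
    have hx := hν.lt x
    -- Reading a unary number destroys it, so it is copied to `dst` and `base` at once, and `r2`
    -- restores it from `base`.
    have r1 := Run.loop_replicate (c := .seq (inc dst) (inc base)) (d := .skip) (n := ν x) (T := 2)
      (e x) (S := fun i => Function.update (Function.update (Function.update s (ν x)
        (List.replicate (e x - i) true)) dst (List.replicate i true ++ s dst)) base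
        (List.replicate i true))
      (by
        intro i hi
        rw [update_of_ne (by omega), update_of_ne (by omega), update_self]) (by
        intro i hi
        convert Run.seq Run.push Run.push using 1
        funext j
        simp only [update_apply]
        grind)
    have r2 := run_mov (a := base) (b := ν x) (by omega) (k := e x)
      (s := Function.update (Function.update (Function.update s (ν x)
        (List.replicate (e x - e x) true)) dst (List.replicate (e x) true ++ s dst)) base
        (List.replicate (e x) true)) (update_self _ _ _)
    have hv := h.vars x
    have hb := h.temps base le_rfl
    refine (Run.seq r1 r2).congr ?_ ?_ ?_
    · funext j
      simp only [update_apply]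
      grind
    · funext j
      simp only [update_apply, eval]
      grind
    · have := he x
      simp only [timeBound, Polynomial.eval_add, Polynomial.eval_mul, Polynomial.eval_X,
        Polynomial.eval_ofNat]
      omega
  | one =>
    intro e X dst base s he hw h h1 h2
    simpa [compile, timeBound, eval] using Run.push (s := s) (n := dst) (b := true)
  | add a b iha ihb =>
    intro e X dst base s he hw h h1 h2
    refine ((iha he hw h h1 h2).seq (ihb he hw (h.update hν hB h1 h2 _) h1 h2)).congr rfl ?_ ?_
    · simp [eval, ← List.append_assoc, add_comm]
    · simp [timeBound]
  | sub a b iha ihb =>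
    intro e X dst base s he hw h h1 h2
    have va := eval_le_valueBound w a he
    have vb := eval_le_valueBound w b he
    have hb0 := h.temps base le_rfl
    have hb1 := h.temps (base + 1) (by omega)
    have r1 := iha he hw (h.mono (show base ≤ base + 2 by omega)) (dst := base) (by omega) (by omega)
    have r2 := ihb he hw ((h.mono (show base ≤ base + 2 by omega)).update hν hB (k := base)
      (by omega) (by omega) (List.replicate (eval w e a) true ++ s base)) (dst := base + 1)
      (by omega) (by omega)
    -- Popping an empty stack does nothing, which is exactly truncated subtraction.
    have r3 := Run.loop_replicate (c := .pop base .skip .skip) (d := .skip) (n := base + 1) (T := 2)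
      (eval w e b) (S := fun i => Function.update (Function.update s base
        (List.replicate (eval w e a - i) true)) (base + 1) (List.replicate (eval w e b - i) true))
      (by
        intro i hi
        rw [update_self]) (by
        intro i hi
        refine (run_pop_skip (k := eval w e a - i) ?_).congr rfl ?_ le_rfl
        · simp
        · funext j
          simp only [update_apply]
          grind)
    have r4 := run_mov (a := base) (b := dst) (by omega) (k := eval w e a - eval w e b)
      (s := Function.update (Function.update s base
        (List.replicate (eval w e a - eval w e b) true)) (base + 1)
          (List.replicate (eval w e b - eval w e b) true)) (by simp)
    refine (r1.seq (r2.seq ((r3.congr ?_ rfl le_rfl).seq r4))).congr rfl ?_ ?_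
    · funext j
      simp only [update_apply]
      grind
    · funext j
      simp only [update_apply, eval]
      grind
    · simp only [timeBound, Polynomial.eval_add, Polynomial.eval_mul, Polynomial.eval_one,
        Polynomial.eval_ofNat]
      omega
  | mul a b iha ihb =>
    intro e X dst base s he hw h h1 h2
    have va := eval_le_valueBound w a he
    have hb0 := h.temps base le_rfl
    have h' := h.mono (Nat.le_succ base)
    have r1 := iha he hw h' (dst := base) (by omega) (by omega)
    have r2 := Run.loop_replicate (c := compile ν b dst (base + 1)) (d := .skip) (n := base)
      (T := b.timeBound.eval X)
      (eval w e a) (S := fun i => Function.update (Function.update s base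
        (List.replicate (eval w e a - i) true)) dst (List.replicate (i * eval w e b) true ++ s dst))
      (by
        intro i hi
        rw [update_of_ne (by omega), update_self]) (by
        intro i hi
        refine (ihb he hw (((h'.update hν hB (by omega) (by omega) _).update hν hB (by omega)
          (by omega) _).update hν hB (by omega) (by omega) _) (by omega) (by omega)).congr rfl ?_
          le_rfl
        have e1 : List.replicate ((i + 1) * eval w e b) true =
            List.replicate (eval w e b) true ++ List.replicate (i * eval w e b) true := by
          rw [List.replicate_append_replicate]
          congr 1
          ring
        rw [e1]
        funext j
        simp only [update_apply]
        grind)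
    refine (r1.seq (r2.congr ?_ rfl le_rfl)).congr rfl ?_ ?_
    · funext j
      simp only [update_apply]
      grind
    · funext j
      simp only [update_apply, eval]
      grind
    · simp only [timeBound, Polynomial.eval_add, Polynomial.eval_mul, Polynomial.eval_one]
      gcongr
  | bit a iha =>
    intro e X dst base s he hw h h1 h2
    have va := eval_le_valueBound w a he
    have hb0 := h.temps base le_rfl
    have h' := h.mono (Nat.le_succ base)
    have hs0 := h.input
    have hs2 := h.aux
    have r1 := iha he hw h' (dst := base) (by omega) (by omega)
    set v := eval w e a with hv
    -- The first `v` bits are set aside in reverse on stack `2`, which brings bit `v` to the top;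
    -- `r4` puts them back. Beyond the end of the string the pops have no effect, in accordance with
    -- the default value `false`.
    have r2 := Run.loop_replicate (c := .pop 0 (.push 2 true) (.push 2 false)) (d := .skip)
      (n := base) (T := 2) v (S := fun i => Function.update (Function.update (Function.update s base
        (List.replicate (v - i) true)) 0 (w.drop i)) 2 (w.take i).reverse)
      (by
        intro i hi
        rw [update_of_ne (by omega), update_of_ne (by omega), update_self]) (by
        intro i hi
        by_cases hl : i < w.length
        · have e' : (w.take (i + 1)).reverse = w[i] :: (w.take i).reverse := by
            rw [← List.take_append_getElem hl]
            simp
          have e1 : (bif w[i] then Cmd.push 2 true else Cmd.push 2 false) = .push 2 w[i] := by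
            cases w[i] <;> rfl
          refine (Run.pop_cons (b := w[i]) (l := w.drop (i + 1)) (T := 1) (s' := _) ?_
            (e1 ▸ Run.push)).congr rfl ?_ le_rfl
          · rw [update_of_ne (by omega), update_of_ne (by omega), update_self,
              List.drop_eq_getElem_cons hl]
          · rw [e']
            funext j
            simp only [update_apply]
            grind
        · have hl' : w.length ≤ i := by omega
          refine (Run.pop_nil ?_).congr rfl ?_ (by omega)
          · rw [update_of_ne (by omega), update_of_ne (by omega), update_self,
              List.drop_eq_nil_of_le hl']
          · rw [List.drop_eq_nil_of_le hl', List.take_of_length_le hl',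
              List.drop_eq_nil_of_le (by omega), List.take_of_length_le (by omega)]
            funext j
            simp only [update_apply]
            grind)
    have r3 : Run (.pop 0 (.seq (inc dst) (.push 0 true)) (.push 0 false))
        (Function.update (Function.update (Function.update s base
          (List.replicate (v - v) true)) 0 (w.drop v)) 2 (w.take v).reverse)
        (Function.update (Function.update (Function.update s 0 (w.drop v)) 2 (w.take v).reverse) dst
          (List.replicate (w.getD v false).toNat true ++ s dst)) 3 := by
      by_cases hl : v < w.length
      · have hd := List.drop_eq_getElem_cons hl
        have hg : w.getD v false = w[v] := by simp [hl]
        rw [hg]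
        cases hb : w[v] with
        | true =>
          refine (Run.pop_cons (b := true) (l := w.drop (v + 1)) ?_
            (Run.seq Run.push Run.push)).congr rfl ?_ (by omega)
          · rw [update_of_ne (by omega), update_self, hd, hb]
          · rw [hd, hb]
            funext j
            simp only [update_apply]
            grind
        | false =>
          refine (Run.pop_cons (b := false) (l := w.drop (v + 1)) ?_ Run.push).congr rfl ?_
            (by omega)
          · rw [update_of_ne (by omega), update_self, hd, hb]
          · rw [hd, hb]
            funext j
            simp only [update_apply]
            grind
      · have hl' : w.length ≤ v := by omega
        have hg : w.getD v false = false := by simp [hl']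
        refine (Run.pop_nil ?_).congr rfl ?_ (by omega)
        · rw [update_of_ne (by omega), update_self, List.drop_eq_nil_of_le hl']
        · rw [hg]
          funext j
          simp only [update_apply]
          grind
    have r4 := run_transfer (a := 2) (b := 0) (by omega) (l := (w.take v).reverse)
      (s := Function.update (Function.update (Function.update s 0 (w.drop v)) 2
        (w.take v).reverse) dst (List.replicate (w.getD v false).toNat true ++ s dst))
      (by rw [update_of_ne (by omega), update_self])
    refine (r1.seq ((r2.congr ?_ rfl le_rfl).seq (r3.seq r4))).congr rfl ?_ ?_
    · funext j
      simp only [update_apply]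
      grind
    · have hd : w.take v ++ w.drop v = w := List.take_append_drop _ _
      funext j
      simp only [update_apply, eval, List.reverse_reverse, ← hv]
      grind
    · simp only [timeBound, Polynomial.eval_add, Polynomial.eval_mul, Polynomial.eval_one,
        Polynomial.eval_ofNat, Polynomial.eval_X, List.length_reverse, List.length_take]
      omega
  | sum x b t ihb iht =>
    intro e X dst base s he hw h h1 h2
    have vb := eval_le_valueBound w b he
    have hb0 := h.temps base le_rfl
    have hb1 := h.temps (base + 1) (by omega)
    have hx := hν.lt x
    have hx' := hν.ge x
    have hvx := h.vars x
    have h' := h.mono (show base ≤ base + 2 by omega)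
    have r1 := ihb he hw h' (dst := base) (by omega) (by omega)
    set v := eval w e b with hv
    set u : ℕ → ℕ := fun i => eval w (Function.update e x i) t
    -- The outer value of `x` is saved on stack `base + 1`, since the stack of `x` serves as the
    -- loop counter; `r5` restores it.
    have r2 := run_mov (a := ν x) (b := base + 1) (by omega) (k := e x)
      (s := Function.update s base (List.replicate v true ++ s base))
      (by rw [update_of_ne (by omega), hvx])
    have r3 := Run.loop_replicate (c := .seq (compile ν t dst (base + 2)) (inc (ν x))) (d := .skip)
      (n := base) (T := t.timeBound.eval (X + b.valueBound.eval X) + 1) v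
      (S := fun i => Function.update (Function.update (Function.update (Function.update s (ν x)
        (List.replicate i true)) base (List.replicate (v - i) true)) (base + 1)
        (List.replicate (e x) true)) dst
        (List.replicate (∑ i ∈ Finset.range i, u i) true ++ s dst))
      (by
        intro i hi
        rw [update_of_ne (by omega), update_of_ne (by omega), update_self]) (by
        intro i hi
        have he' : ∀ y, Function.update e x i y ≤ X + b.valueBound.eval X := by
          intro y
          have := he y
          by_cases h : y = x <;> simp [h] <;> omega
        refine (Run.seq (iht he' (by omega) (((((h'.update_var hν (by omega) x i).update hν hB
          (by omega) (by omega) _).update hν hB (by omega) (by omega) _).update hν hB (by omega)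
          (by omega) _).update hν hB (by omega) (by omega) _) (by omega) (by omega))
          Run.push).congr rfl ?_ le_rfl
        have e1 : List.replicate (∑ i ∈ Finset.range (i + 1), u i) true =
            List.replicate (u i) true ++ List.replicate (∑ i ∈ Finset.range i, u i) true := by
          rw [List.replicate_append_replicate, Finset.sum_range_succ, add_comm]
        rw [e1]
        rw [show eval w (Function.update e x i) t = u i from rfl]
        funext j
        simp only [update_apply]
        grind)
    have r4 := run_clear (a := ν x) (l := List.replicate v true)
      (s := Function.update (Function.update (Function.update (Function.update s (ν x)
        (List.replicate v true)) base (List.replicate (v - v) true)) (base + 1)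
        (List.replicate (e x) true)) dst
        (List.replicate (∑ i ∈ Finset.range v, u i) true ++ s dst))
      (by rw [update_of_ne (by omega), update_of_ne (by omega), update_of_ne (by omega),
        update_self])
    have r5 := run_mov (a := base + 1) (b := ν x) (by omega) (k := e x)
      (s := Function.update (Function.update (Function.update (Function.update (Function.update s
        (ν x) (List.replicate v true)) base (List.replicate (v - v) true)) (base + 1)
        (List.replicate (e x) true)) dst
        (List.replicate (∑ i ∈ Finset.range v, u i) true ++ s dst)) (ν x) [])
      (by rw [update_of_ne (by omega), update_of_ne (by omega), update_self])
    refine (r1.seq (r2.seq ((r3.congr ?_ rfl le_rfl).seq (r4.seq r5)))).congr rfl ?_ ?_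
    · funext j
      simp only [update_apply, Finset.range_zero, Finset.sum_empty]
      grind
    · funext j
      simp only [update_apply, eval, ← hv]
      grind
    · have := he x
      have hm := Nat.mul_le_mul_right
        (t.timeBound.eval (X + b.valueBound.eval X) + 1 + 1) vb
      simp only [timeBound, Polynomial.eval_add, Polynomial.eval_mul, Polynomial.eval_one,
        Polynomial.eval_ofNat, Polynomial.eval_X, Polynomial.eval_comp, List.length_replicate]
      omega

end

/-- If the answers to a decision problem are given by a term with a variable for the length of the
input, then the problem is solvable in polynomial time. -/
theorem decidableInPolyTime {α : Type} [Fintype V] {enc : α → List Bool} {f : α → Bool} (N : V)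
    (t : Term V) (h : ∀ a, eval (enc a) (Pi.single N (enc a).length) t ≠ 0 ↔ f a = true) :
    DecidableInPolyTime enc f := by
  set B := 3 + Fintype.card V with hBdef
  set ν : V → ℕ := fun x => 3 + Fintype.equivFin V x with hνdef
  have hν : Layout ν B :=
    ⟨fun x y hxy => by simpa [hνdef, Fin.val_inj] using hxy, fun x => Nat.le_add_right _ _,
      fun x => Nat.add_lt_add_left (Fintype.equivFin V x).2 3⟩
  have hB : 3 ≤ B := Nat.le_add_right _ _
  have hN := hν.lt N
  have hN' := hν.ge N
  -- Truncated subtraction from one turns the value of `t` into a bit. Both the bit and its negation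
  -- are computed because a program can react only to a nonempty stack.
  set no : Term V := sub one t
  set yes : Term V := sub one no
  refine decidableInPolyTime_of_exec
    (.seq (.loop 0 (.seq (.push 2 true) (inc (ν N))) (.seq (.push 2 false) (inc (ν N))))
      (.seq (transfer 2 0) (.seq (compile ν yes B (B + 2)) (.seq (compile ν no (B + 1) (B + 2))
        (.seq (clear 0) (.seq (clear (ν N))
          (.seq (.pop B (.push 1 true) .skip) (.pop (B + 1) (.push 1 false) .skip))))))))
    (Polynomial.X * 3 + 1 + (Polynomial.X * 2 + 1 + (yes.timeBound + (no.timeBound +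
      (Polynomial.X * 2 + 1 + (Polynomial.X * 2 + 1 + (2 + 2)))))))
    fun a => ?_
  set w := enc a
  set X := w.length with hX
  -- One pass over the input counts its length into `N`; it reverses the string onto stack `2`, and
  -- `r2` undoes this.
  have r1 := Run.loop (c := .seq (.push 2 true) (inc (ν N))) (d := .seq (.push 2 false) (inc (ν N)))
    (n := 0) (T := 2) w (S := fun i => Function.update (Function.update
      (Function.update (fun _ => []) 0 (w.drop i)) 2 (w.take i).reverse) (ν N)
        (List.replicate i true))
    (by
      intro i hi
      rw [update_of_ne (by omega), update_of_ne (by omega), update_self]) (by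
      intro i hi
      have e1 : (bif w[i] then Cmd.seq (.push 2 true) (inc (ν N)) else
          .seq (.push 2 false) (inc (ν N))) = .seq (.push 2 w[i]) (inc (ν N)) := by
        cases w[i] <;> rfl
      have e' : (w.take (i + 1)).reverse = w[i] :: (w.take i).reverse := by
        rw [← List.take_append_getElem hi]
        simp
      rw [e1, e']
      refine (Run.seq Run.push Run.push).congr rfl ?_ le_rfl
      funext j
      simp only [update_apply]
      grind)
  have r2 := run_transfer (a := 2) (b := 0) (by omega) (l := w.reverse)
    (s := Function.update (Function.update
      (Function.update (fun _ => []) 0 []) 2 w.reverse) (ν N) (List.replicate w.length true))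
    (by rw [update_of_ne (by omega), update_self])
  set s0 : Store := Function.update (Function.update (fun _ => []) 0 w) (ν N)
    (List.replicate w.length true) with hs0
  have he : ∀ x, (Pi.single N X : V → ℕ) x ≤ X := by
    intro x
    by_cases hx : x = N
    · subst hx
      simp
    · simp [hx]
  have h0 : Holds ν w (Pi.single N X) (B + 2) s0 := by
    refine ⟨?_, ?_, fun x => ?_, fun j hj => ?_⟩
    · rw [hs0, update_of_ne (by omega), update_self]
    · rw [hs0, update_of_ne (by omega), update_of_ne (by omega)]
    · have := hν.ge x
      by_cases hx : x = N
      · subst hx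
        simp [hs0, hX]
      · rw [hs0, update_of_ne (hν.inj.ne hx), update_of_ne (by omega)]
        simp [hx]
    · rw [hs0, update_of_ne (by omega), update_of_ne (by omega)]
  have r3 := run_compile hν hB yes he le_rfl h0 (dst := B) le_rfl (by omega)
  have r4 := run_compile hν hB no he le_rfl (h0.update hν hB (k := B) le_rfl (by omega)
    (List.replicate (eval w (Pi.single N X) yes) true ++ s0 B)) (dst := B + 1) (by omega)
    (by omega)
  have hv : eval w (Pi.single N X) yes = (f a).toNat ∧
      eval w (Pi.single N X) no = (!f a).toNat := by
    have : eval w (Pi.single N X) t ≠ 0 ↔ f a = true := h a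
    simp only [yes, no, eval]
    cases hf : f a with
    | true =>
      have := this.2 hf
      simp only [Bool.toNat_true, Bool.not_true, Bool.toNat_false]
      omega
    | false =>
      have : eval w (Pi.single N X) t = 0 := by
        by_contra hne
        simp [this.1 hne] at hf
      simp [this]
  rw [hv.1] at r3 r4
  rw [hv.2] at r4
  have r5 := run_clear (a := 0) (l := w) (s := Function.update (Function.update s0 B
    (List.replicate (f a).toNat true)) (B + 1) (List.replicate (!f a).toNat true))
    (by rw [update_of_ne (by omega), update_of_ne (by omega), h0.input])
  have r6 := run_clear (a := ν N) (l := List.replicate X true)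
    (s := Function.update (Function.update (Function.update s0 B
      (List.replicate (f a).toNat true)) (B + 1) (List.replicate (!f a).toNat true)) 0 [])
    (by rw [update_of_ne (by omega), update_of_ne (by omega), update_of_ne (by omega), hs0,
      update_self])
  -- Exactly one of the stacks `B` and `B + 1` is nonempty, so exactly one answer is written and
  -- both stacks end up empty.
  have r7 : Run (.seq (.pop B (.push 1 true) .skip) (.pop (B + 1) (.push 1 false) .skip))
      (Function.update (Function.update (fun _ => []) B (List.replicate (f a).toNat true)) (B + 1)
        (List.replicate (!f a).toNat true))
      (Function.update (fun _ => []) 1 [f a]) (2 + 2) := by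
    cases f a with
    | true =>
      refine (Run.seq (Run.pop_cons (b := true) (l := []) ?_ Run.push)
        (Run.pop_nil ?_)).congr rfl ?_ (by omega)
      · rw [update_of_ne (by omega), update_self]
        rfl
      · rw [update_of_ne (by omega), update_of_ne (by omega), update_self]
        rfl
      · funext j
        simp only [update_apply]
        grind
    | false =>
      refine (Run.seq (Run.pop_nil ?_) (Run.pop_cons (b := true) (l := []) ?_ Run.push)).congr
        rfl ?_ (by omega)
      · rw [update_of_ne (by omega), update_self]
        rfl
      · rw [update_self]
        rfl
      · funext j
        simp only [update_apply]
        grind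
  have ht0 : s0 B = [] ∧ s0 (B + 1) = [] := by
    constructor <;> rw [hs0, update_of_ne (by omega), update_of_ne (by omega)]
  have r1' := r1.congr (r := Function.update (fun _ => []) 0 w) (T' := X * 3 + 1) (by
    funext j
    simp only [update_apply]
    grind) rfl le_rfl
  have r2' := r2.congr (r := Function.update (Function.update (Function.update (fun _ => []) 0
    (w.drop w.length)) 2 (w.take w.length).reverse) (ν N) (List.replicate w.length true))
    (r' := s0) (T' := X * 2 + 1) (by simp) (by
    funext j
    simp only [hs0, update_apply]
    grind) (by simp [hX])
  have r5' := r5.congr (T' := X * 2 + 1) (r := Function.update (Function.update s0 B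
    (List.replicate (f a).toNat true ++ s0 B)) (B + 1) (List.replicate (!f a).toNat true ++
      Function.update s0 B (List.replicate (f a).toNat true ++ s0 B) (B + 1))) (by
    funext j
    simp only [update_apply]
    grind) rfl le_rfl
  have r6' := r6.congr rfl (T' := X * 2 + 1) (r' := Function.update (Function.update (fun _ => [])
    B (List.replicate (f a).toNat true)) (B + 1) (List.replicate (!f a).toNat true)) (by
    funext j
    simp only [hs0, update_apply]
    grind) (by simp)
  obtain ⟨T, hT, hE⟩ := r1'.seq (r2'.seq (r3.seq (r4.seq (r5'.seq (r6'.seq r7)))))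
  exact ⟨T, hT.trans (le_of_eq (by simp)), hE⟩

end Term

/-! ### Combinatorics of votes: extensions, scores and counting by vote types -/

namespace BucklinRank

section Voting

variable {V C : Type}

section LinearOrder

variable [Finite C] {T : C → C → Prop} [IsLinearOrder C T]

theorem position_pos (c : C) : 0 < position T c :=
  (Set.ncard_pos).2 ⟨c, refl_of T c⟩

theorem position_le_of_rel {a b : C} (h : T a b) : position T a ≤ position T b :=
  Set.ncard_le_ncard fun _ hx => trans_of T hx h

theorem position_lt_of_rel {a b : C} (h : T a b) (hab : a ≠ b) : position T a < position T b := by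
  refine Set.ncard_lt_ncard ⟨fun _ hx => trans_of T hx h, fun hs => hab ?_⟩
  exact antisymm_of T h (hs (show T b b from refl_of T b))

theorem position_injective : Function.Injective (position T) := by
  intro a b h
  by_contra hab
  rcases total_of T a b with h' | h'
  · exact (position_lt_of_rel h' hab).ne h
  · exact (position_lt_of_rel h' (Ne.symm hab)).ne h.symm

/-- Positions are distinct and start at `1`, so at most `s` candidates fit into the first `s`. -/
theorem ncard_position_le (s : ℕ) : {a : C | position T a ≤ s}.ncard ≤ s := by
  have h : (position T '' {a : C | position T a ≤ s}) ⊆ (Finset.Icc 1 s : Finset ℕ) := by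
    rintro _ ⟨a, ha, rfl⟩
    exact Finset.mem_coe.2 (Finset.mem_Icc.2 ⟨position_pos a, ha⟩)
  rw [← Set.ncard_image_of_injective _ (position_injective (T := T))]
  refine (Set.ncard_le_ncard h (Finset.finite_toSet _)).trans ?_
  rw [Set.ncard_coe_finset]
  simp

end LinearOrder

/-- A partial order has a linear extension that is compatible with a given grading. -/
theorem exists_linear_extension_of_level {P : C → C → Prop} [IsPartialOrder C P] (l : C → ℕ)
    (hl : ∀ a b, P a b → l a ≤ l b) :
    ∃ T : C → C → Prop, IsLinearOrder C T ∧ (∀ a b, P a b → T a b) ∧ ∀ a b, T a b → l a ≤ l b := by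
  obtain ⟨S, hS, hPS⟩ := extend_partialOrder P
  -- Lexicographic order: level first, then an arbitrary linear extension within a level.
  refine ⟨fun a b => l a < l b ∨ l a = l b ∧ S a b, ?_, ?_, ?_⟩
  · exact {
      refl := fun a => .inr ⟨rfl, refl_of S a⟩
      trans := by
        rintro a b c (h | ⟨h, h1⟩) (h' | ⟨h', h2⟩)
        · exact .inl (h.trans h')
        · exact .inl (h' ▸ h)
        · exact .inl (h ▸ h')
        · exact .inr ⟨h.trans h', trans_of S h1 h2⟩
      antisymm := by
        rintro a b (h | ⟨h, h1⟩) (h' | ⟨h', h2⟩)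
        · omega
        · omega
        · omega
        · exact antisymm_of S h1 h2
      total := by
        intro a b
        rcases lt_trichotomy (l a) (l b) with h | h | h
        · exact .inl (.inl h)
        · exact (total_of S a b).imp (fun x => .inr ⟨h, x⟩) (fun x => .inr ⟨h.symm, x⟩)
        · exact .inr (.inl h) }
  · intro a b h
    rcases (hl a b h).lt_or_eq with h' | h'
    · exact .inl h'
    · exact .inr ⟨h', hPS _ _ h⟩
  · rintro a b (h | ⟨h, -⟩)
    · exact h.le
    · exact h.le

/-- A set of rivals that a voter puts among the top candidates, and whether the voter keeps the
given candidate away from there. -/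
abbrev VoteType (k : ℕ) : Type := Finset (Fin k) × Bool

/-- A numerical criterion for a partial order `P` to have a linear extension in which the rivals
`d i` with `i ∈ τ.1` have position at most `s`, or `s + 1` if `u i` holds, and where `c` has
position greater than `s` if `τ.2` is true. -/
def Feasible {k : ℕ} (P : C → C → Prop) (c : C) (d : Fin k → C) (u : Fin k → Prop) (s : ℕ)
    (τ : VoteType k) : Prop :=
  {a | ∃ i ∈ τ.1, ¬ u i ∧ P a (d i)}.ncard ≤ s ∧ {a | ∃ i ∈ τ.1, P a (d i)}.ncard ≤ s + 1 ∧
    (τ.2 = true → (∀ i ∈ τ.1, ¬ P c (d i)) ∧ {a | P c a}.ncard + s ≤ Nat.card C)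

section Feasible

variable [Finite C] {k : ℕ} {P : C → C → Prop} {c : C} {d : Fin k → C} {u : Fin k → Prop} {s : ℕ}

open Classical in
-- The candidates forced above the urgent rivals (those with `¬ u i`) go first, then those forced
-- above the other chosen rivals. If `c` is to be kept away, it goes last together with everything
-- forced below it. The conditions in `Feasible` say that these blocks do not conflict and have
-- suitable sizes.
theorem Feasible.exists_extension [IsPartialOrder C P] {τ : VoteType k}
    (h : Feasible P c d u s τ) :
    ∃ T : C → C → Prop, IsLinearOrder C T ∧ (∀ a b, P a b → T a b) ∧
      (∀ i ∈ τ.1, position T (d i) ≤ if u i then s + 1 else s) ∧ (τ.2 = true → s < position T c) := by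
  obtain ⟨h1, h2, h3⟩ := h
  set U₁ : Set C := {a | ∃ i ∈ τ.1, ¬ u i ∧ P a (d i)}
  set U₂ : Set C := {a | ∃ i ∈ τ.1, P a (d i)}
  set W : Set C := {a | τ.2 = true ∧ P c a}
  have up₁ : ∀ a b, P a b → b ∈ U₁ → a ∈ U₁ := by
    rintro a b hab ⟨i, hi, hu, hb⟩
    exact ⟨i, hi, hu, trans_of P hab hb⟩
  have up₂ : ∀ a b, P a b → b ∈ U₂ → a ∈ U₂ := by
    rintro a b hab ⟨i, hi, hb⟩
    exact ⟨i, hi, trans_of P hab hb⟩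
  have down : ∀ a b, P a b → a ∈ W → b ∈ W := by
    rintro a b hab ⟨ht, ha⟩
    exact ⟨ht, trans_of P ha hab⟩
  have sub : U₁ ⊆ U₂ := fun a ⟨i, hi, _, ha⟩ => ⟨i, hi, ha⟩
  have disj : ∀ a ∈ U₂, a ∉ W := by
    rintro a ⟨i, hi, ha⟩ ⟨ht, hc⟩
    exact (h3 ht).1 i hi (trans_of P hc ha)
  have mem₁ : ∀ i ∈ τ.1, ¬ u i → d i ∈ U₁ := fun i hi hu => ⟨i, hi, hu, refl_of P _⟩
  have mem₂ : ∀ i ∈ τ.1, d i ∈ U₂ := fun i hi => ⟨i, hi, refl_of P _⟩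
  have memW : τ.2 = true → c ∈ W := fun ht => ⟨ht, refl_of P c⟩
  have of_memW : ∀ a ∈ W, P c a := fun a h => h.2
  clear_value U₁ U₂ W
  -- `U₁` and `U₂` are closed upwards, `W` is closed downwards and disjoint from `U₂`, so the levels
  -- respect `P`.
  obtain ⟨T, hT, hPT, hlT⟩ := exists_linear_extension_of_level (P := P)
    (fun a => if a ∈ U₁ then 0 else if a ∈ U₂ then 1 else if a ∈ W then 3 else 2) (by
      intro a b hab
      have := up₁ a b hab
      have := up₂ a b hab
      have := down a b hab
      have := disj a
      have := disj b
      grind)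
  refine ⟨T, hT, hPT, fun i hi => ?_, fun ht => ?_⟩
  · split_ifs with hu
    · refine (Set.ncard_le_ncard (fun a ha => ?_)).trans h2
      have hm := mem₂ i hi
      have := hlT a (d i) ha
      have := @sub a
      grind
    · refine (Set.ncard_le_ncard (fun a ha => ?_)).trans h1
      have hm := mem₁ i hi hu
      have := hlT a (d i) ha
      grind
  · have hcW := memW ht
    have hcU : c ∉ U₂ := fun h => disj c h hcW
    have hcU₁ : c ∉ U₁ := fun h => hcU (sub h)
    -- Every candidate not forced below `c` precedes it, so the position of `c` is at least one more
    -- than their number.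
    have hsub : insert c {a | P c a}ᶜ ⊆ {a | T a c} := by
      rintro a (rfl | ha)
      · exact refl_of T a
      · rcases total_of T a c with h | h
        · exact h
        · exfalso
          have haW : a ∉ W := fun h => ha (of_memW a h)
          have := hlT c a h
          grind
    have hle := Set.ncard_le_ncard hsub
    rw [Set.ncard_insert_of_notMem (show c ∉ {a | P c a}ᶜ from fun h => h (refl_of P c))] at hle
    have := Set.ncard_add_ncard_compl {a | P c a}
    have := (h3 ht).2
    unfold position
    omega

open Classical in
theorem feasible_of_extension {T : C → C → Prop} [IsLinearOrder C T]
    (hPT : ∀ a b, P a b → T a b) (hd : ∀ i, d i ≠ c) :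
    Feasible P c d u s
      (Finset.univ.filter fun i => position T (d i) ≤ if u i then s + 1 else s,
        decide (s < position T c)) := by
  refine ⟨?_, ?_, fun ht => ⟨fun i hi hc => ?_, ?_⟩⟩
  · refine (Set.ncard_le_ncard ?_).trans (ncard_position_le (T := T) s)
    rintro a ⟨i, hi, hu, ha⟩
    have := (Finset.mem_filter.1 hi).2
    rw [if_neg hu] at this
    exact (position_le_of_rel (hPT _ _ ha)).trans this
  · refine (Set.ncard_le_ncard ?_).trans (ncard_position_le (T := T) (s + 1))
    rintro a ⟨i, hi, ha⟩
    have := (Finset.mem_filter.1 hi).2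
    refine (position_le_of_rel (hPT _ _ ha)).trans (this.trans ?_)
    split_ifs <;> omega
  -- If `c` were forced above such a rival, its position would be less than `s + 1`, contrary to its
  -- being kept out of the top `s`.
  · have h1 := (Finset.mem_filter.1 hi).2
    have h2 := position_lt_of_rel (hPT _ _ hc) (hd i).symm
    have h3 := of_decide_eq_true ht
    split_ifs at h1 <;> omega
  · have h3 : s < position T c := of_decide_eq_true ht
    -- The candidates forced below `c` and those ranked above it overlap only in `c`, so the two
    -- cardinalities add up to at most one more than the number of candidates.
    have hi : {a | P c a} ∩ {a | T a c} ⊆ {c} := by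
      rintro a ⟨h, h'⟩
      exact antisymm_of T h' (hPT _ _ h)
    have h4 := Set.ncard_le_ncard hi
    rw [Set.ncard_singleton] at h4
    have h5 := Set.ncard_union_add_ncard_inter {a | P c a} {a | T a c}
    have h6 := Set.ncard_le_card ({a | P c a} ∪ {a | T a c})
    unfold position at h3
    omega

end Feasible

section Score

variable [Finite V] [Nonempty V] [Finite C]

/-- The minimum is attained and `topCount` is monotone in the threshold, so bounds on scores become
majority conditions. -/
theorem score_le_iff (T : V → C → C → Prop) (c : C) (t : ℕ) :
    score T c ≤ t ↔ Nat.card V < 2 * topCount T c t := by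
  refine ⟨fun h => (score_spec T c).trans_le (Nat.mul_le_mul_left 2 ?_), fun h => Nat.sInf_le h⟩
  exact Set.ncard_le_ncard fun v hv => le_trans hv h

theorem score_pos (T : V → C → C → Prop) (hT : ∀ v, IsLinearOrder C (T v)) (c : C) :
    0 < score T c := by
  by_contra h
  have h' := (score_le_iff T c 0).1 (by omega)
  have : {v : V | position (T v) c ≤ 0} = ∅ := by
    ext v
    have := hT v
    have := position_pos (T := T v) c
    simp only [Set.mem_ofPred_eq, Set.mem_empty_iff_false, iff_false]
    omega
  rw [topCount, this, Set.ncard_empty] at h'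
  omega

theorem score_le_card (T : V → C → C → Prop) (c : C) : score T c ≤ Nat.card C := by
  have h : {v : V | position (T v) c ≤ Nat.card C} = Set.univ :=
    Set.eq_univ_of_forall fun v => Set.ncard_le_card _
  have h0 : 0 < Nat.card V := Nat.card_pos
  rw [score_le_iff, topCount, h, Set.ncard_univ]
  omega

open Classical in
/-- The rank of `c` exceeds `k` if there are `k` rivals that reach a majority in time. -/
theorem lt_rank_iff {T : V → C → C → Prop} (hT : ∀ v, IsLinearOrder C (T v))
    {tie : C → C → Prop} [IsLinearOrder C tie] {c : C} {k : ℕ} :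
    k < rank T tie c ↔ ∃ s ≤ Nat.card C, ∃ d : Fin k → C, Function.Injective d ∧
      (∀ i, d i ≠ c) ∧
      (∀ i, Nat.card V < 2 * topCount T (d i) (if tie (d i) c then s + 1 else s)) ∧
      2 * topCount T c s ≤ Nat.card V := by
  have hc : c ∈ {a | resultOrder T tie a c} := .inr ⟨rfl, refl_of tie c⟩
  have h1 : k < rank T tie c ↔ k ≤ ({a | resultOrder T tie a c} \ {c}).ncard := by
    -- The rank counts `c` itself, so exceeding `k` means having at least `k` others in front.
    rw [← Nat.lt_add_one_iff, Set.ncard_sdiff_singleton_add_one hc]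
    rfl
  rw [h1]
  constructor
  · intro h
    have hf : Nonempty (Fin k ↪ ({a | resultOrder T tie a c} \ {c} : Set C)) := by
      have := Fintype.ofFinite ({a | resultOrder T tie a c} \ {c} : Set C)
      refine Function.Embedding.nonempty_of_card_le ?_
      rwa [Fintype.card_fin, ← Nat.card_eq_fintype_card, Nat.card_coe_set_eq]
    obtain ⟨f⟩ := hf
    have hp := score_pos T hT c
    -- The threshold is the last one at which `c` has no majority; the score is positive, so the
    -- subtraction is not truncated.
    refine ⟨score T c - 1, (Nat.sub_le _ _).trans (score_le_card T c), fun i => f i,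
      fun i j hij => f.injective (Subtype.ext hij), fun i => (f i).2.2, fun i => ?_, ?_⟩
    · rw [← score_le_iff]
      change score T (f i) ≤ if tie (f i) c then _ else _
      rcases (f i).2.1 with h | ⟨h, h'⟩
      · split_ifs <;> omega
      · rw [if_pos h']
        omega
    · rw [← not_lt, ← score_le_iff]
      omega
  · rintro ⟨s, -, d, hd, hdc, hdt, hs⟩
    -- Any threshold below the score of `c` suffices: a rival with score at most `s` is strictly
    -- better, and one with score at most `s + 1` is at worst tied and then wins by the tiebreaker.
    rw [← not_lt, ← score_le_iff] at hs
    have hr : Set.range d ⊆ {a | resultOrder T tie a c} \ {c} := by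
      rintro _ ⟨i, rfl⟩
      refine ⟨?_, hdc i⟩
      have := hdt i
      rw [← score_le_iff] at this
      split_ifs at this with ht
      · rcases Nat.lt_or_ge (score T (d i)) (score T c) with h | h
        · exact .inl h
        · exact .inr ⟨by omega, ht⟩
      · exact .inl (by omega)
    have := Set.ncard_le_ncard hr
    rwa [← Set.image_univ, Set.ncard_image_of_injective _ hd, Set.ncard_univ, Nat.card_fin] at this

end Score

section Counting

variable [Fintype V] {τ : Type} [Fintype τ]

open Classical in
/-- A function whose values lie in given sets amounts, as far as the number of times a property is
attained is concerned, to numbers `x A t` that say how often `t` is chosen from the set `A`. -/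
theorem exists_choice_iff (F : V → Finset τ) (R : ((τ → Prop) → ℕ) → Prop) :
    (∃ g : V → τ, (∀ v, g v ∈ F v) ∧ R fun p => {v | p (g v)}.ncard) ↔
      ∃ x : Finset τ → τ → ℕ, (∀ A t, x A t ≤ Nat.card V) ∧
        (∀ A, ∑ t ∈ A, x A t = {v | F v = A}.ncard) ∧
        R fun p => ∑ A, ∑ t ∈ A with p t, x A t := by
  have count : ∀ g : V → τ, (∀ v, g v ∈ F v) → ∀ p : τ → Prop,
      {v | p (g v)}.ncard = ∑ A, ∑ t ∈ A with p t, {v | F v = A ∧ g v = t}.ncard := by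
    intro g hg p
    simp only [Set.ncard_eq_toFinset_card', Set.toFinset_ofPred]
    rw [Finset.card_eq_sum_card_fiberwise (f := F) (t := Finset.univ) (fun _ _ => by simp)]
    refine Finset.sum_congr rfl fun A _ => ?_
    rw [Finset.card_eq_sum_card_fiberwise (f := g) (t := A.filter p)]
    · refine Finset.sum_congr rfl fun t ht => ?_
      congr 1
      ext v
      have := (Finset.mem_filter.1 ht).2
      simp only [Finset.mem_filter, Finset.mem_univ, true_and]
      constructor
      · rintro ⟨⟨-, h⟩, h'⟩
        exact ⟨h, h'⟩
      · rintro ⟨h, rfl⟩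
        exact ⟨⟨this, h⟩, rfl⟩
    · intro v hv
      simp only [Finset.coe_filter, Finset.mem_filter, Finset.mem_univ, true_and,
        Set.mem_ofPred_eq] at hv ⊢
      exact ⟨hv.2 ▸ hg v, hv.1⟩
  constructor
  · rintro ⟨g, hg, hR⟩
    refine ⟨fun A t => {v | F v = A ∧ g v = t}.ncard, fun A t => Set.ncard_le_card _, fun A => ?_,
      ?_⟩
    · simp only [Set.ncard_eq_toFinset_card', Set.toFinset_ofPred]
      rw [Finset.card_eq_sum_card_fiberwise (f := g) (t := A)]
      · simp only [Finset.filter_filter]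
      · intro v hv
        simp only [Finset.coe_filter, Finset.mem_univ, true_and, Set.mem_ofPred_eq] at hv
        exact hv ▸ hg v
    · convert hR using 1
      funext p
      exact (count g hg p).symm
  · rintro ⟨x, -, hx, hR⟩
    -- The numbers `x A t` add up to the size of the class of `A`, so the class can be split into
    -- blocks of these sizes, and each voter chooses the label of its block.
    have e : ∀ A : Finset τ, Nonempty ({v // F v = A} ≃ Σ t : A, Fin (x A t)) := by
      intro A
      refine ⟨Fintype.equivOfCardEq ?_⟩
      have := hx A
      rw [Set.ncard_eq_toFinset_card', Set.toFinset_ofPred] at this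
      rw [Fintype.card_subtype, ← this, Fintype.card_sigma, ← Finset.sum_coe_sort]
      simp
    have e := fun A => (e A).some
    set g : V → τ := fun v => (e (F v) ⟨v, rfl⟩).1
    have ge : ∀ A (w : {v // F v = A}), g w = (e A w).1 := by
      rintro A ⟨v, rfl⟩
      rfl
    have hgF : ∀ v, g v ∈ F v := fun v => (e (F v) ⟨v, rfl⟩).1.2
    refine ⟨g, hgF, ?_⟩
    convert hR using 1
    funext p
    rw [count g hgF p]
    refine Finset.sum_congr rfl fun A _ => Finset.sum_congr rfl fun t ht => ?_
    have htA := (Finset.mem_filter.1 ht).1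
    have h1 : {v | F v = A ∧ g v = t} =
        (fun y => ((e A).symm y : V)) '' Set.range (Sigma.mk (β := fun t : A => Fin (x A t))
          ⟨t, htA⟩) := by
      ext v
      constructor
      · rintro ⟨hv, hv'⟩
        refine ⟨e A ⟨v, hv⟩, ?_, by simp⟩
        have := ge A ⟨v, hv⟩
        generalize e A ⟨v, hv⟩ = y at this
        obtain ⟨t', i⟩ := y
        have ht' : t' = ⟨t, htA⟩ := Subtype.ext (this.symm.trans hv')
        subst ht'
        exact ⟨i, rfl⟩
      · rintro ⟨_, ⟨i, rfl⟩, rfl⟩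
        exact ⟨((e A).symm _).2, by simp [ge]⟩
    have h2 : Function.Injective fun y => ((e A).symm y : V) :=
      Subtype.val_injective.comp (e A).symm.injective
    rw [h1, Set.ncard_image_of_injective _ h2, ← Set.image_univ,
      Set.ncard_image_of_injective _ sigma_mk_injective, Set.ncard_univ, Nat.card_fin]

end Counting

open Classical in
/-- The maximal rank of `c` exceeds `k` if and only if there are a threshold `s`, rivals `d` and
numbers `x` satisfying certain inequalities. -/
theorem lt_maxRank_iff [Fintype V] [Nonempty V] [Finite C] {P : V → C → C → Prop}
    (hP : ∀ v, IsPartialOrder C (P v)) {tie : C → C → Prop} [IsLinearOrder C tie] {c : C} {k : ℕ} :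
    k < maxRank P tie c ↔ ∃ s ≤ Nat.card C, ∃ d : Fin k → C, Function.Injective d ∧
      (∀ i, d i ≠ c) ∧ ∃ x : Finset (VoteType k) → VoteType k → ℕ, (∀ A t, x A t ≤ Nat.card V) ∧
        (∀ A, ∑ t ∈ A, x A t =
          {v | ∀ t, t ∈ A ↔ Feasible (P v) c d (fun i => tie (d i) c) s t}.ncard) ∧
        (∀ i, Nat.card V < 2 * ∑ A, ∑ t ∈ A with i ∈ t.1, x A t) ∧
        Nat.card V ≤ 2 * ∑ A, ∑ t ∈ A with t.2 = true, x A t := by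
  have h1 : k < maxRank P tie c ↔ ∃ T, IsCompletion P T ∧ k < rank T tie c := by
    constructor
    · intro h
      obtain ⟨T, hT, hr⟩ := (isGreatest_maxRank P hP tie c).1
      exact ⟨T, hT, hr ▸ h⟩
    · rintro ⟨T, hT, hr⟩
      exact hr.trans_le ((isGreatest_maxRank P hP tie c).2 ⟨T, hT, rfl⟩)
  have h2 : (∃ T, IsCompletion P T ∧ k < rank T tie c) ↔ ∃ s ≤ Nat.card C, ∃ d : Fin k → C,
      Function.Injective d ∧ (∀ i, d i ≠ c) ∧ ∃ T, IsCompletion P T ∧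
        (∀ i, Nat.card V < 2 * topCount T (d i) (if tie (d i) c then s + 1 else s)) ∧
        2 * topCount T c s ≤ Nat.card V := by
    constructor
    · rintro ⟨T, hT, hr⟩
      obtain ⟨s, hs, d, hd, hdc, h⟩ := (lt_rank_iff fun v => (hT v).1).1 hr
      exact ⟨s, hs, d, hd, hdc, T, hT, h⟩
    · rintro ⟨s, hs, d, hd, hdc, T, hT, h⟩
      exact ⟨T, hT, (lt_rank_iff fun v => (hT v).1).2 ⟨s, hs, d, hd, hdc, h⟩⟩
  rw [h1, h2]
  refine exists_congr fun s => and_congr_right fun hs => exists_congr fun d =>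
    and_congr_right fun hd => and_congr_right fun hdc => ?_
  -- For fixed `s` and `d`, choosing a completion amounts to choosing a feasible type for each
  -- voter; the choice lemma then reduces this to counting.
  set Q : V → VoteType k → Prop := fun v => Feasible (P v) c d (fun i => tie (d i) c) s
  have h3 := exists_choice_iff (fun v => Finset.univ.filter (Q v))
    (fun N => (∀ i, Nat.card V < 2 * N fun t => i ∈ t.1) ∧ Nat.card V ≤ 2 * N fun t => t.2 = true)
  have h4 : ∀ A, {v | Finset.univ.filter (Q v) = A} = {v | ∀ t, t ∈ A ↔ Q v t} := by
    intro A
    ext v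
    simp only [Set.mem_ofPred_eq, Finset.ext_iff, Finset.mem_filter, Finset.mem_univ, true_and]
    exact forall_congr' fun t => Iff.comm
  simp only [h4] at h3
  rw [← h3]
  -- Passing to complements makes the condition on `c` a lower bound too. A completion therefore
  -- only has to do at least as well as the chosen types promise.
  have compl : ∀ T : V → C → C → Prop,
      {v | s < position (T v) c}.ncard + topCount T c s = Nat.card V := by
    intro T
    rw [← Set.ncard_add_ncard_compl {v | s < position (T v) c}]
    have : {v | s < position (T v) c}ᶜ = {v | position (T v) c ≤ s} := by
      ext v
      simp
    rw [this]
    rfl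
  constructor
  · rintro ⟨T, hT, h, h'⟩
    refine ⟨fun v => (Finset.univ.filter fun i => position (T v) (d i) ≤
      if tie (d i) c then s + 1 else s, decide (s < position (T v) c)), fun v => ?_, fun i => ?_, ?_⟩
    · have := (hT v).1
      exact Finset.mem_filter.2 ⟨Finset.mem_univ _, feasible_of_extension (hT v).2 hdc⟩
    · simpa [topCount] using h i
    · have := compl T
      simp only [decide_eq_true_eq]
      omega
  · rintro ⟨g, hg, h, h'⟩
    have ex := fun v => have := hP v; (Finset.mem_filter.1 (hg v)).2.exists_extension
    choose T hT hPT hd hc using ex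
    refine ⟨T, fun v => ⟨hT v, hPT v⟩, fun i => (h i).trans_le (Nat.mul_le_mul_left 2 ?_), ?_⟩
    · exact Set.ncard_le_ncard fun v hv => hd v i hv
    · have h5 := compl T
      have h6 : {v | (g v).2 = true}.ncard ≤ {v | s < position (T v) c}.ncard :=
        Set.ncard_le_ncard fun v hv => hc v hv
      omega

end Voting

end BucklinRank

/-! ### Bounded logic and counting inside terms -/

namespace Term

open Function

variable {V : Type}

/-- The number zero. -/
def zero : Term V := sub one one

/-- Negation of a term read as a truth value. -/
def not (t : Term V) : Term V := sub one t

/-- The term is nonzero if and only if `a ≤ b`. -/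
def le (a b : Term V) : Term V := sub (add b one) a

/-- The term is nonzero if and only if `a < b`. -/
def lt (a b : Term V) : Term V := sub b a

/-- The term is nonzero if and only if `a = b`. -/
def eq (a b : Term V) : Term V := mul (le a b) (le b a)

/-- The universal quantifier over the numbers below `b`. -/
def all (x : V) (b t : Term V) : Term V := not (sum x b (not t))

/-- The number of numbers below `b` for which `t` is nonzero. -/
def count (x : V) (b t : Term V) : Term V := sum x b (not (not t))

/-- The conjunction of a finite family. -/
noncomputable def conj {ι : Type} (s : Finset ι) (f : ι → Term V) : Term V :=
  (s.toList.map f).foldr mul one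

/-- The sum (or disjunction) of a finite family. -/
noncomputable def total {ι : Type} (s : Finset ι) (f : ι → Term V) : Term V :=
  (s.toList.map f).foldr add zero

/-- The existential quantifiers over the variables in `l`, with values up to that of `N`. -/
def exMany (N : V) : List V → Term V → Term V
  | [], t => t
  | x :: l, t => sum x (add (var N) one) (exMany N l t)

variable [DecidableEq V] {w : List Bool} {e : V → ℕ}

/-- The term has a nonzero value. -/
def Sat (w : List Bool) (e : V → ℕ) (t : Term V) : Prop := eval w e t ≠ 0

theorem eval_zero : eval w e zero = 0 := rfl

theorem sat_one : Sat w e one := one_ne_zero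

theorem sat_not {t : Term V} : Sat w e (not t) ↔ ¬ Sat w e t := by
  simp only [Sat, not, eval]
  omega

theorem sat_mul {a b : Term V} : Sat w e (mul a b) ↔ Sat w e a ∧ Sat w e b := by
  simp [Sat, eval]

theorem sat_le {a b : Term V} : Sat w e (le a b) ↔ eval w e a ≤ eval w e b := by
  simp only [Sat, le, eval]
  omega

theorem sat_lt {a b : Term V} : Sat w e (lt a b) ↔ eval w e a < eval w e b := by
  simp only [Sat, lt, eval]
  omega

theorem sat_eq {a b : Term V} : Sat w e (eq a b) ↔ eval w e a = eval w e b := by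
  rw [eq, sat_mul, sat_le, sat_le, le_antisymm_iff]

theorem sat_sum {x : V} {b t : Term V} :
    Sat w e (sum x b t) ↔ ∃ i < eval w e b, Sat w (update e x i) t := by
  simp [Sat, eval, Finset.sum_eq_zero_iff]

theorem sat_all {x : V} {b t : Term V} :
    Sat w e (all x b t) ↔ ∀ i < eval w e b, Sat w (update e x i) t := by
  simp [all, sat_not, sat_sum]

theorem sat_bit {a : Term V} : Sat w e (bit a) ↔ w.getD (eval w e a) false = true := by
  simp only [Sat, eval]
  cases w.getD (eval w e a) false <;> simp

/-- The double negation replaces each nonzero value by `1`, so the sum counts. -/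
theorem eval_count {x : V} {b t : Term V} {m : ℕ} (h : eval w e b = m) :
    eval w e (count x b t) = {i : Fin m | Sat w (update e x i) t}.ncard := by
  classical
  have : ∀ i, eval w (update e x i) (not (not t)) = if Sat w (update e x i) t then 1 else 0 := by
    intro i
    by_cases h : eval w (update e x i) t = 0
    · simp [not, eval, Sat, h]
    · have : 1 - (1 - eval w (update e x i) t) = 1 := by omega
      simp [not, eval, Sat, h, this]
  simp only [count, eval, h, this]
  rw [Finset.sum_range, Set.ncard_eq_toFinset_card', Set.toFinset_ofPred, Finset.card_filter]

theorem sat_conj {ι : Type} {s : Finset ι} {f : ι → Term V} :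
    Sat w e (conj s f) ↔ ∀ i ∈ s, Sat w e (f i) := by
  have : ∀ l : List ι, Sat w e ((l.map f).foldr mul one) ↔ ∀ i ∈ l, Sat w e (f i) := by
    intro l
    induction l with
    | nil => simp [sat_one]
    | cons a l ih => simp [sat_mul, ih]
  simp [conj, this]

theorem eval_total {ι : Type} {s : Finset ι} {f : ι → Term V} :
    eval w e (total s f) = ∑ i ∈ s, eval w e (f i) := by
  have : ∀ l : List ι, eval w e ((l.map f).foldr add zero) = (l.map fun i => eval w e (f i)).sum := by
    intro l
    induction l with
    | nil => simp [eval_zero]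
    | cons a l ih => simp [eval, ih]
  rw [total, this, Finset.sum_map_toList]

theorem sat_total {ι : Type} {s : Finset ι} {f : ι → Term V} :
    Sat w e (total s f) ↔ ∃ i ∈ s, Sat w e (f i) := by
  rw [Sat, eval_total]
  simp [Sat, Finset.sum_eq_zero_iff]

/-- The bounding variable is not among those quantified, so the bound `e N` is the same at every
stage of the nesting. -/
theorem sat_exMany {N : V} {l : List V} (hN : N ∉ l) {t : Term V} :
    Sat w e (exMany N l t) ↔
      ∃ e' : V → ℕ, (∀ x ∉ l, e' x = e x) ∧ (∀ x ∈ l, e' x ≤ e N) ∧ Sat w e' t := by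
  induction l generalizing e with
  | nil =>
    constructor
    · intro h
      exact ⟨e, by simp, by simp, h⟩
    · rintro ⟨e', h, -, ht⟩
      have : e' = e := funext fun x => h x (by simp)
      exact this ▸ ht
  | cons y l ih =>
    simp only [List.mem_cons, not_or] at hN
    simp only [exMany, sat_sum, eval]
    constructor
    · rintro ⟨i, hi, h⟩
      obtain ⟨e', h1, h2, h3⟩ := (ih hN.2).1 h
      rw [update_of_ne hN.1] at h2
      refine ⟨e', fun x hx => ?_, fun x hx => ?_, h3⟩
      · simp only [List.mem_cons, not_or] at hx
        rw [h1 x hx.2, update_of_ne hx.1]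
      · by_cases hxl : x ∈ l
        · exact h2 x hxl
        · have hxy : x = y := by simpa [hxl] using hx
          subst hxy
          rw [h1 x hxl, update_self]
          omega
    · rintro ⟨e', h1, h2, h3⟩
      refine ⟨e' y, Nat.lt_succ_of_le (h2 y (by simp)), (ih hN.2).2 ⟨e', fun x hx => ?_,
        fun x hx => ?_, h3⟩⟩
      · by_cases hxy : x = y
        · subst hxy
          simp
        · rw [update_of_ne hxy, h1 x (by simp [hxy, hx])]
      · rw [update_of_ne hN.1]
        exact h2 x (by simp [hx])

end Term

/-! ### Locating the fields of the encoded input -/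

namespace BucklinRank

section Bits

theorem getD_unary_append {a i : ℕ} {y : List Bool} (h : i < a) :
    (unary a ++ y).getD i false = true := by
  simp [unary, List.getD_eq_getElem?_getD, List.getElem?_append, h]

theorem getD_unary_append_self {a : ℕ} {y : List Bool} :
    (unary a ++ y).getD a false = false := by
  simp [unary, List.getD_eq_getElem?_getD]

theorem getD_unary_append_add {a i : ℕ} {y : List Bool} :
    (unary a ++ y).getD (a + 1 + i) false = y.getD i false := by
  have h : (unary a).length = a + 1 := by simp [unary]
  rw [List.getD_append_right _ _ _ _ (by omega), h]
  simp

/-- A number in unary is the index of the first zero bit. This lets a guessed value be verified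
instead of computed. -/
theorem unary_eq_iff {a b : ℕ} {y : List Bool} :
    ((∀ i < b, (unary a ++ y).getD i false = true) ∧ ¬ (unary a ++ y).getD b false = true) ↔
      b = a := by
  constructor
  · rintro ⟨h, h'⟩
    rcases lt_trichotomy a b with hab | hab | hab
    · have := h a hab
      rw [getD_unary_append_self] at this
      simp at this
    · exact hab.symm
    · exact absurd (getD_unary_append hab) h'
  · rintro rfl
    exact ⟨fun i hi => getD_unary_append hi, by rw [getD_unary_append_self]; simp⟩

/-- Blocks of equal length allow direct addressing: block `i` starts at `i * L`. -/
theorem getD_flatMap_append {ι : Type} {l : List ι} {f : ι → List Bool} {L : ℕ}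
    (hf : ∀ a, (f a).length = L) {y : List Bool} {i j : ℕ} (hi : i < l.length) (hj : j < L) :
    (l.flatMap f ++ y).getD (i * L + j) false = (f l[i]).getD j false := by
  induction l generalizing i with
  | nil => simp at hi
  | cons a l ih =>
    rw [List.flatMap_cons, List.append_assoc]
    cases i with
    | zero =>
      rw [List.getD_append _ _ _ _ (by rw [hf]; omega)]
      simp
    | succ i =>
      rw [List.getD_append_right _ _ _ _ (by rw [hf, add_mul]; omega), hf,
        show (i + 1) * L + j - L = i * L + j by rw [add_mul]; omega,
        ih (by simpa using hi)]
      simp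

theorem getD_relBits_append {m : ℕ} (r : Fin m → Fin m → Prop) (a b : Fin m) (y : List Bool) :
    (relBits r ++ y).getD (a * m + b) false = true ↔ r a b := by
  rw [relBits, getD_flatMap_append (L := m) (by simp) (by simp) b.2]
  simp [List.getD_eq_getElem?_getD]

end Bits

end BucklinRank

/-! ### The term for the decision problem and its correctness -/

namespace BucklinRank

open Term
open Function (update update_self update_of_ne Injective)

/-- The variables of the term that solves the problem: the length of the input, the numbers of
candidates and voters, the given candidate, a threshold, two bound variables for voters and
candidates, the rivals, and the numbers of voters of each kind. -/
inductive Name (k : ℕ) : Type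
  | len : Name k
  | cands : Name k
  | voters : Name k
  | cand : Name k
  | thr : Name k
  | voter : Name k
  | idx : Name k
  | rival : Fin k → Name k
  | num : Finset (VoteType k) → VoteType k → Name k
  deriving DecidableEq, Fintype

section Terms

variable {k : ℕ}

/-- The position in the input where the matrices begin. -/
def offsetTerm : Term (Name k) :=
  add (add (add (var .cands) one) (add (var .voters) one)) (add (var .cand) one)

/-- The input begins with the numbers of candidates and voters and the given candidate. -/
def headerTerm : Term (Name k) :=
  mul (mul (all .idx (var .cands) (bit (var .idx))) (not (bit (var .cands))))
    (mul
      (mul (all .idx (var .voters) (bit (add (add (var .cands) one) (var .idx))))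
        (not (bit (add (add (var .cands) one) (var .voters)))))
      (mul (all .idx (var .cand)
          (bit (add (add (add (var .cands) one) (add (var .voters) one)) (var .idx))))
        (not (bit (add (add (add (var .cands) one) (add (var .voters) one)) (var .cand))))))

/-- The tiebreaker prefers `a` to `b`. -/
def tieTerm (a b : Term (Name k)) : Term (Name k) :=
  bit (add offsetTerm (add (mul a (var .cands)) b))

/-- The current voter prefers `a` to `b`. -/
def prefTerm (a b : Term (Name k)) : Term (Name k) :=
  bit (add offsetTerm (add (mul (var .cands) (var .cands))
    (add (mul (var .voter) (mul (var .cands) (var .cands))) (add (mul a (var .cands)) b))))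

/-- The vote type `t` is feasible for the current voter. -/
noncomputable def feasibleTerm (t : VoteType k) : Term (Name k) :=
  mul
    (le (count .idx (var .cands) (total t.1 fun i =>
      mul (not (tieTerm (var (.rival i)) (var .cand))) (prefTerm (var .idx) (var (.rival i)))))
      (var .thr))
    (mul
      (le (count .idx (var .cands) (total t.1 fun i => prefTerm (var .idx) (var (.rival i))))
        (add (var .thr) one))
      (if t.2 = true then
        mul (conj t.1 fun i => not (prefTerm (var .cand) (var (.rival i))))
          (le (add (count .idx (var .cands) (prefTerm (var .cand) (var .idx))) (var .thr))
            (var .cands))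
      else one))

/-- The rivals are distinct candidates other than the given one. -/
noncomputable def rivalsTerm : Term (Name k) :=
  conj Finset.univ fun i => mul (lt (var (.rival i)) (var .cands))
    (mul (not (eq (var (.rival i)) (var .cand)))
      (conj (Finset.univ.filter fun j => i ≠ j) fun j =>
        not (eq (var (.rival i)) (var (.rival j)))))

/-- The numbers of voters of each kind match the numbers of voters with given feasible types. -/
noncomputable def classesTerm : Term (Name k) :=
  conj Finset.univ fun A : Finset (VoteType k) =>
    mul (conj Finset.univ fun t => le (var (.num A t)) (var .voters))
      (eq (total A fun t => var (.num A t))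
        (count .voter (var .voters) (conj Finset.univ fun t =>
          if t ∈ A then feasibleTerm t else not (feasibleTerm t))))

/-- Each rival reaches a majority in time, and the given candidate does not. -/
noncomputable def majorityTerm : Term (Name k) :=
  mul
    (conj Finset.univ fun i : Fin k => lt (var .voters) (mul (add one one)
      (total Finset.univ fun A : Finset (VoteType k) =>
        total (A.filter fun t => i ∈ t.1) fun t => var (.num A t))))
    (le (var .voters) (mul (add one one)
      (total Finset.univ fun A : Finset (VoteType k) =>
        total (A.filter fun t => t.2 = true) fun t => var (.num A t))))

/-- The conditions on the quantified variables. -/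
noncomputable def bodyTerm : Term (Name k) :=
  mul headerTerm (mul (le (var .thr) (var .cands))
    (mul rivalsTerm (mul classesTerm majorityTerm)))

/-- The term that solves the problem. -/
noncomputable def rankTerm (k : ℕ) : Term (Name k) :=
  exMany .len (Finset.univ.filter fun x => x ≠ .len).toList bodyTerm

end Terms

section Correctness

variable {k : ℕ} {I : Instance} {e : Name k → ℕ}

/-- Once one field has been verified, the offset of the next one is known, so the three unary fields
are checked in succession. -/
theorem sat_headerTerm : Sat I.encode e headerTerm ↔
    e .cands = I.m ∧ e .voters = I.n ∧ e .cand = I.cand := by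
  simp only [headerTerm, sat_mul, sat_not, sat_all, sat_bit, eval, update_self, ne_eq,
    reduceCtorEq, not_false_eq_true, update_of_ne]
  have h1 := unary_eq_iff (a := I.m) (b := e .cands) (y := unary I.n ++ unary I.cand ++
    relBits I.tie ++ (List.finRange I.n).flatMap fun v => relBits (I.pref v))
  have h2 := unary_eq_iff (a := I.n) (b := e .voters) (y := unary I.cand ++
    relBits I.tie ++ (List.finRange I.n).flatMap fun v => relBits (I.pref v))
  have h3 := unary_eq_iff (a := I.cand) (b := e .cand) (y :=
    relBits I.tie ++ (List.finRange I.n).flatMap fun v => relBits (I.pref v))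
  simp only [Instance.encode, List.append_assoc] at h1 h2 h3 ⊢
  rw [h1]
  refine and_congr_right fun hm => ?_
  simp only [hm, getD_unary_append_add]
  rw [h2]
  refine and_congr_right fun hn => ?_
  simp only [hn, add_assoc (I.m + 1) (I.n + 1), getD_unary_append_add]
  rw [h3]

/-- The variables for the dimensions and the given candidate have the values from the input. -/
structure Matches (I : Instance) (e : Name k → ℕ) : Prop where
  cands : e .cands = I.m
  voters : e .voters = I.n
  cand : e .cand = I.cand

theorem encode_getD_add (I : Instance) (i : ℕ) :
    I.encode.getD (I.m + 1 + (I.n + 1) + (I.cand + 1) + i) false =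
      (relBits I.tie ++ (List.finRange I.n).flatMap fun v => relBits (I.pref v)).getD i false := by
  simp only [Instance.encode, List.append_assoc]
  rw [add_assoc, add_assoc, getD_unary_append_add, getD_unary_append_add, getD_unary_append_add]

theorem sat_tieTerm (h : Matches I e) {a b : Term (Name k)} {x y : Fin I.m}
    (ha : eval I.encode e a = x) (hb : eval I.encode e b = y) :
    Sat I.encode e (tieTerm a b) ↔ I.tie x y := by
  rw [tieTerm, sat_bit]
  simp only [offsetTerm, eval, h.cands, h.voters, h.cand, ha, hb]
  rw [encode_getD_add, getD_relBits_append]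

theorem sat_prefTerm (h : Matches I e) {a b : Term (Name k)} {x y : Fin I.m} {v : Fin I.n}
    (hv : e .voter = v) (ha : eval I.encode e a = x) (hb : eval I.encode e b = y) :
    Sat I.encode e (prefTerm a b) ↔ I.pref v x y := by
  rw [prefTerm, sat_bit]
  simp only [offsetTerm, eval, h.cands, h.voters, h.cand, ha, hb, hv]
  -- The entry must lie inside the matrix of voter `v`, not in that of a later voter.
  have hj : (x : ℕ) * I.m + y < I.m * I.m := by
    have := x.2
    have := y.2
    nlinarith
  rw [encode_getD_add, List.getD_append_right _ _ _ _ (by rw [relBits_length]; omega),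
    relBits_length, Nat.add_sub_cancel_left]
  have := getD_flatMap_append (l := List.finRange I.n) (f := fun v => relBits (I.pref v))
    (L := I.m * I.m) (fun v => relBits_length _) (y := []) (i := v) (j := x * I.m + y)
    (by simp) hj
  rw [List.append_nil] at this
  rw [this]
  simpa using getD_relBits_append (I.pref v) x y []

theorem sat_feasibleTerm (h : Matches I e) {d : Fin k → Fin I.m}
    (hd : ∀ i, e (.rival i) = d i) {v : Fin I.n} (hv : e .voter = v) (t : VoteType k) :
    Sat I.encode e (feasibleTerm t) ↔
      Feasible (I.pref v) I.cand d (fun i => I.tie (d i) I.cand) (e .thr) t := by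
  have hm : ∀ a : Fin I.m, Matches I (update e .idx a) := fun a =>
    ⟨by simpa using h.cands, by simpa using h.voters, by simpa using h.cand⟩
  have hcands : eval I.encode e (var .cands) = I.m := h.cands
  have e1 : ∀ (a : Fin I.m) i, Sat I.encode (update e .idx a)
      (prefTerm (var .idx) (var (.rival i))) ↔ I.pref v a (d i) := fun a i =>
    sat_prefTerm (hm a) (by simpa using hv) (by simp [eval]) (by simpa [eval] using hd i)
  have e2 : ∀ (a : Fin I.m) i, Sat I.encode (update e .idx a)
      (tieTerm (var (.rival i)) (var .cand)) ↔ I.tie (d i) I.cand := fun a i =>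
    sat_tieTerm (hm a) (by simpa [eval] using hd i) (by simpa [eval] using h.cand)
  have e3 : ∀ (a : Fin I.m), Sat I.encode (update e .idx a)
      (prefTerm (var .cand) (var .idx)) ↔ I.pref v I.cand a := fun a =>
    sat_prefTerm (hm a) (by simpa using hv) (by simpa [eval] using h.cand) (by simp [eval])
  have e4 : ∀ i, Sat I.encode e (prefTerm (var .cand) (var (.rival i))) ↔ I.pref v I.cand (d i) :=
    fun i => sat_prefTerm h hv (by simpa [eval] using h.cand) (by simpa [eval] using hd i)
  unfold feasibleTerm Feasible
  rw [sat_mul, sat_mul, sat_le, sat_le, eval_count hcands, eval_count hcands]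
  simp only [sat_total, sat_mul, sat_not, e1, e2]
  refine and_congr Iff.rfl (and_congr Iff.rfl ?_)
  split_ifs with ht
  · rw [sat_mul, sat_conj, sat_le]
    simp only [eval, eval_count hcands, sat_not, e3, e4, ht, true_implies, Nat.card_fin, h.cands]
  · simp [ht, sat_one]

theorem sat_rivalsTerm (h : Matches I e) : Sat I.encode e rivalsTerm ↔
    ∃ d : Fin k → Fin I.m, (∀ i, e (.rival i) = d i) ∧ Injective d ∧ ∀ i, d i ≠ I.cand := by
  simp only [rivalsTerm, sat_conj, sat_mul, sat_lt, sat_not, sat_eq, eval, h.cands, h.cand,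
    Finset.mem_univ, Finset.mem_filter, true_and, true_implies]
  constructor
  · intro H
    refine ⟨fun i => ⟨e (.rival i), (H i).1⟩, fun i => rfl, fun i j hij => ?_, fun i hi => ?_⟩
    · by_contra hne
      exact (H i).2.2 j hne (congrArg Fin.val hij)
    · exact (H i).2.1 (congrArg Fin.val hi)
  · rintro ⟨d, hd, hinj, hc⟩ i
    refine ⟨by rw [hd]; exact (d i).2, fun hi => hc i (Fin.ext (by rw [← hd, hi])),
      fun j hij hne => hij (hinj (Fin.ext (by rw [← hd, ← hd, hne])))⟩

theorem sat_classesTerm (h : Matches I e) {d : Fin k → Fin I.m} (hd : ∀ i, e (.rival i) = d i) :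
    Sat I.encode e classesTerm ↔ (∀ A t, e (.num A t) ≤ I.n) ∧
      ∀ A, ∑ t ∈ A, e (.num A t) = {v | ∀ t, t ∈ A ↔
        Feasible (I.pref v) I.cand d (fun i => I.tie (d i) I.cand) (e .thr) t}.ncard := by
  have hf : ∀ (v : Fin I.n) t, Sat I.encode (update e .voter v) (feasibleTerm t) ↔
      Feasible (I.pref v) I.cand d (fun i => I.tie (d i) I.cand) (e .thr) t := by
    intro v t
    have := sat_feasibleTerm (e := update e .voter (v : ℕ)) (I := I) (d := d) (v := v)
      ⟨by simpa using h.cands, by simpa using h.voters, by simpa using h.cand⟩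
      (fun i => by simpa using hd i) (by simp) t
    simpa using this
  have hg : ∀ (v : Fin I.n) (A : Finset (VoteType k)) t, Sat I.encode (update e .voter v)
      (if t ∈ A then feasibleTerm t else not (feasibleTerm t)) ↔
      (t ∈ A ↔ Feasible (I.pref v) I.cand d (fun i => I.tie (d i) I.cand) (e .thr) t) := by
    intro v A t
    split_ifs with ht
    · simp [ht, hf]
    · simp [ht, hf, sat_not]
  have hvoters : eval I.encode e (var .voters) = I.n := h.voters
  simp only [classesTerm, sat_conj, sat_mul, sat_le, sat_eq, eval, h.voters, eval_total,
    eval_count hvoters, hg, Finset.mem_univ, true_implies]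
  exact forall_and

theorem sat_majorityTerm (h : Matches I e) : Sat I.encode e majorityTerm ↔
    (∀ i : Fin k, I.n < 2 * ∑ A : Finset (VoteType k), ∑ t ∈ A with i ∈ t.1, e (.num A t)) ∧
      I.n ≤ 2 * ∑ A : Finset (VoteType k), ∑ t ∈ A with t.2 = true, e (.num A t) := by
  simp only [majorityTerm, sat_mul, sat_conj, sat_lt, sat_le, eval, eval_total, h.voters,
    Finset.mem_univ, true_implies, Nat.reduceAdd]

/-- The dimensions are written in unary, so all numbers in the search are at most the input length,
the common bound of the quantifiers in `rankTerm`. -/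
theorem le_length_encode (I : Instance) : I.m + I.n ≤ I.encode.length := by
  simp only [Instance.encode, unary, List.length_append, List.length_replicate]
  omega

theorem sat_rankTerm (k : ℕ) (I : Instance) :
    Sat I.encode (Pi.single .len I.encode.length) (rankTerm k) ↔
      k < maxRank I.pref I.tie I.cand := by
  have : Nonempty (Fin I.n) := ⟨⟨0, I.voters_pos⟩⟩
  have := I.tie_linear
  rw [rankTerm, sat_exMany (by simp), lt_maxRank_iff I.pref_partial, Nat.card_fin, Nat.card_fin]
  constructor
  · rintro ⟨e, -, -, H⟩
    simp only [bodyTerm, sat_mul, sat_le, eval] at H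
    obtain ⟨hh, hs, hr, hc, hm⟩ := H
    obtain ⟨h1, h2, h3⟩ := sat_headerTerm.1 hh
    have h : Matches I e := ⟨h1, h2, h3⟩
    obtain ⟨d, hd, hinj, hdc⟩ := (sat_rivalsTerm h).1 hr
    obtain ⟨hx, hA⟩ := (sat_classesTerm h hd).1 hc
    exact ⟨e .thr, h1 ▸ hs, d, hinj, hdc, fun A t => e (.num A t), hx, by convert hA,
      (sat_majorityTerm h).1 hm⟩
  · rintro ⟨s, hs, d, hinj, hdc, x, hx, hA, hm⟩
    have hl := le_length_encode I
    have hcand := I.cand.2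
    let e : Name k → ℕ := fun y => match y with
      | .len => I.encode.length
      | .cands => I.m
      | .voters => I.n
      | .cand => I.cand
      | .thr => s
      -- These two names are quantified at the outside as well, but every occurrence is bound again
      -- inside, so their values are irrelevant.
      | .voter => 0
      | .idx => 0
      | .rival i => d i
      | .num A t => x A t
    have h : Matches I e := ⟨rfl, rfl, rfl⟩
    refine ⟨e, fun y hy => ?_, fun y _ => ?_, ?_⟩
    · have : y = .len := by simpa using hy
      subst this
      simp [e]
    · rw [Pi.single_eq_same]
      cases y with
      | rival i =>
        have := (d i).2
        simp only [e]
        omega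
      | num A t =>
        have := hx A t
        simp only [e]
        omega
      | _ =>
        simp only [e]
        omega
    · simp only [bodyTerm, sat_mul, sat_le, eval]
      exact ⟨sat_headerTerm.2 ⟨rfl, rfl, rfl⟩, hs, (sat_rivalsTerm h).2 ⟨d, fun _ => rfl, hinj, hdc⟩,
        (sat_classesTerm h (d := d) fun _ => rfl).2 ⟨hx, by convert hA⟩, (sat_majorityTerm h).2 hm⟩

end Correctness

end BucklinRank

theorem mainTheorem12 (k : ℕ) (hk : 1 ≤ k) :
    DecidableInPolyTime BucklinRank.Instance.encode (BucklinRank.maxRankExceeds k) := by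
  refine Term.decidableInPolyTime .len (BucklinRank.rankTerm k) fun I => ?_
  refine (BucklinRank.sat_rankTerm k I).trans ?_
  simp [BucklinRank.maxRankExceeds]
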